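/- Conventions. A simplicial complex $X$ is regarded as a metric space through its vertex set $X^{(0)}$ with the edge-path metric $d_X$. It is uniformly locally finite if there is a uniform bound on the number of simplices containing a given vertex, and flag if every finite nonempty set of pairwise adjacent vertices spans a simplex. It is $6$-large if it is flag and every embedded cycle of length $4$ or $5$ has a diagonal (an edge joining two nonconsecutive vertices of the cycle). It is systolic if it is connected and simply connected and the link of each of its simplices is $6$-large. An isometry of $X$ is a simplicial automorphism; it is hyperbolic if it maps no simplex to itself. For a hyperbolic isometry $h$ let $L(h)=\min_{x\in X^{(0)}} d_X(x,h(x))$, and let $\mathrm{Min}(h)$ be the subcomplex spanned by the vertices $x$ with $d_X(x,h(x))=L(h)$, with the metric induced from $d_X$. An axis of $h$ is an $h$-invariant bi-infinite geodesic of vertices in $X$, considered up to parametrisation. The graph of axes $Y(h)$ has as vertices the axes of $h$ contained in $\mathrm{Min}(h)$; two distinct axes $\gamma_1,\gamma_2$ are joined by an edge if $\min\{d_X(x_1,x_2): x_1\in\gamma_1,\ x_2\in\gamma_2\}\le 1$. Let $d_{Y(h)}$ be its edge-path metric. Every axis is ordered so that $x\prec h(x)$ for each vertex $x$ on it. **Theorem.**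 Let $h$ be a hyperbolic isometry of a uniformly locally finite systolic complex $X$. Assume that $L(h)>3$ and that through every vertex of $\mathrm{Min}(h)$ there passes an axis of $h$. Then $Y(h)$ is nonempty and connected, and axes contained in $\mathrm{Min}(h)$ can be parametrised as geodesics $\mathbb Z\to X^{(0)}$ increasing with respect to $\prec$. Fix any such axis $\gamma_0$ with any such parametrisation, and let $\Omega=\{x\in X^{(0)} : d_X(\gamma_0(-n),x)\le n \text{ for some integer } n\ge 0\}$. Then each axis $\gamma\in Y(h)$ has exactly one parametrisation $\gamma\colon\mathbb Z\to X^{(0)}$ as a geodesic increasing with respect to $\prec$ such that $\gamma(0)$ is the $\prec$-maximal vertex of $\gamma\cap\Omega$. With these parametrisations the map $$c\colon (Y(h)\times\mathbb Z,\ d_h)\to(\mathrm{Min}(h),d_X),\qquad c(\gamma,t)=\gamma(t),$$ is surjective onto the vertices of $\mathrm{Min}(h)$ and is a quasi-isometry, where $$d_h((\gamma_1,t_1),(\gamma_2,t_2))=d_{Y(h)}(\gamma_1,\gamma_2)+|t_1-t_2|.$$ Here a map $f\colon(A,d_A)\to(B,d_B)$ is a quasi-isometric embedding if there are real numbers $\lambda>0$,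 $\mu\ge 0$, $b$, $b'$ with $\lambda\,d_A(x,y)-b\le d_B(f(x),f(y))\le \mu\,d_A(x,y)+b'$ for all $x,y\in A$; it is a quasi-isometry if moreover there is a quasi-isometric embedding $g\colon B\to A$ such that $g\circ f$ and $f\circ g$ are at bounded distance from the respective identity maps. -/

import Mathlib

namespace Systolic

/-! ### Simplicial complexes -/

/-- The 1-skeleton of a simplicial complex: two distinct vertices are adjacent when they lie in a
common simplex (equivalently, when they span an edge). -/
def skeleton {V : Type*} (K : PreAbstractSimplicialComplex V) : SimpleGraph V where
  Adj u v := u ≠ v ∧ ∃ s ∈ K.faces, u ∈ s ∧ v ∈ s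
  symm := ⟨fun _ _ h => ⟨h.1.symm, h.2.imp fun _ hs => ⟨hs.1, hs.2.2, hs.2.1⟩⟩⟩
  loopless := ⟨fun _ h => h.1 rfl⟩

/-- The link of `σ`: the simplices which are disjoint from `σ` and which together with `σ` span a
simplex. -/
def link {V : Type*} (K : PreAbstractSimplicialComplex V) (σ : Finset V) :
    PreAbstractSimplicialComplex V where
  faces := {τ | τ.Nonempty ∧ Disjoint σ τ ∧ ∃ ρ ∈ K.faces, σ ⊆ ρ ∧ τ ⊆ ρ}
  isRelLowerSet_faces := by
    rintro τ ⟨hne, hdisj, ρ, hρ, hσ, hτ⟩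
    exact ⟨hne, fun τ' hle hne' =>
      ⟨hne', Finset.disjoint_of_subset_right hle hdisj, ρ, hρ, hσ, hle.trans hτ⟩⟩

/-- A complex is flag if every finite nonempty set of pairwise adjacent vertices spans a simplex. -/
def IsFlag {V : Type*} (K : PreAbstractSimplicialComplex V) : Prop :=
  ∀ s : Finset V, s.Nonempty → (∀ v ∈ s, {v} ∈ K.faces) →
    (∀ u ∈ s, ∀ v ∈ s, u ≠ v → (skeleton K).Adj u v) → s ∈ K.faces

/-- A complex is `k`-large if it is flag and every embedded cycle `c` of length `4 ≤ n < k` has a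
diagonal, i.e. an edge joining two nonconsecutive vertices of the cycle. -/
def IsLarge {V : Type*} (k : ℕ) (K : PreAbstractSimplicialComplex V) : Prop :=
  IsFlag K ∧
  ∀ n : ℕ, 4 ≤ n → n < k → ∀ c : ZMod n → V, Function.Injective c →
    (∀ i, (skeleton K).Adj (c i) (c (i + 1))) →
    ∃ i j : ZMod n, j ≠ i + 1 ∧ i ≠ j + 1 ∧ (skeleton K).Adj (c i) (c j)

/-- Homotopy rel endpoints of edge-paths in a simplicial complex: the equivalence relation
generated by deleting a backtrack and by replacing two consecutive edges of a simplex by its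
third edge, at any place of the path. -/
inductive EdgeHomotopic {V : Type*} (K : PreAbstractSimplicialComplex V) :
    ∀ {u v : V}, (skeleton K).Walk u v → (skeleton K).Walk u v → Prop
  | refl {u v : V} (p : (skeleton K).Walk u v) : EdgeHomotopic K p p
  | symm {u v : V} {p q : (skeleton K).Walk u v} (h : EdgeHomotopic K p q) : EdgeHomotopic K q p
  | trans {u v : V} {p q r : (skeleton K).Walk u v} (h₁ : EdgeHomotopic K p q)
      (h₂ : EdgeHomotopic K q r) : EdgeHomotopic K p r
  | cons {u v w : V} (e : (skeleton K).Adj u v) {p q : (skeleton K).Walk v w}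
      (h : EdgeHomotopic K p q) :
      EdgeHomotopic K (SimpleGraph.Walk.cons e p) (SimpleGraph.Walk.cons e q)
  | backtrack {u v w : V} (e : (skeleton K).Adj u v) (e' : (skeleton K).Adj v u)
      (p : (skeleton K).Walk u w) :
      EdgeHomotopic K (SimpleGraph.Walk.cons e (SimpleGraph.Walk.cons e' p)) p
  | triangle {u v w z : V} (s : Finset V) (hs : s ∈ K.faces) (hu : u ∈ s) (hv : v ∈ s)
      (hw : w ∈ s) (e : (skeleton K).Adj u v) (e' : (skeleton K).Adj v w)
      (e'' : (skeleton K).Adj u w) (p : (skeleton K).Walk w z) :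
      EdgeHomotopic K (SimpleGraph.Walk.cons e (SimpleGraph.Walk.cons e' p))
        (SimpleGraph.Walk.cons e'' p)

/-- The edge-path group (which is the fundamental group) is trivial at every vertex: every closed
edge-path is homotopic to a constant path. -/
def IsSimplyConnected {V : Type*} (K : PreAbstractSimplicialComplex V) : Prop :=
  ∀ (v : V) (p : (skeleton K).Walk v v), EdgeHomotopic K p SimpleGraph.Walk.nil

/-- A systolic (that is, 6-systolic) complex: connected, simply connected, and the link of every
simplex is 6-large. -/
structure IsSystolic {V : Type*} (X : AbstractSimplicialComplex V) : Prop where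
  connected : (skeleton X.toPreAbstractSimplicialComplex).Connected
  simplyConnected : IsSimplyConnected X.toPreAbstractSimplicialComplex
  link_large : ∀ σ ∈ X.faces, IsLarge 6 (link X.toPreAbstractSimplicialComplex σ)

/-- The number of simplices containing a given vertex is bounded uniformly over all vertices. -/
def IsUniformlyLocallyFinite {V : Type*} (X : AbstractSimplicialComplex V) : Prop :=
  ∃ N : ℕ, ∀ v : V, {s ∈ X.faces | v ∈ s}.encard ≤ N

/-- The combinatorial distance between vertices: the least number of edges of a connecting
edge-path. -/
noncomputable def vdist {V : Type*} (X : AbstractSimplicialComplex V) (u v : V) : ℕ :=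
  (skeleton X.toPreAbstractSimplicialComplex).dist u v

/-! ### Hyperbolic isometries -/

/-- `h` is a simplicial automorphism (an isometry) of `X`. -/
def IsAutomorphism {V : Type*} (X : AbstractSimplicialComplex V) (h : V ≃ V) : Prop :=
  ∀ s : Finset V, s.map h.toEmbedding ∈ X.faces ↔ s ∈ X.faces

/-- `h` is a hyperbolic isometry: a simplicial automorphism mapping no simplex to itself. -/
def IsHyperbolic {V : Type*} (X : AbstractSimplicialComplex V) (h : V ≃ V) : Prop :=
  IsAutomorphism X h ∧ ∀ s ∈ X.faces, s.map h.toEmbedding ≠ s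

/-- The translation length `L(h)`: the minimum of the displacement function `v ↦ d(v, h v)`. -/
noncomputable def translationLength {V : Type*} (X : AbstractSimplicialComplex V) (h : V ≃ V) :
    ℕ :=
  sInf (Set.range fun v => vdist X v (h v))

/-- The vertex set of the minimal displacement set `Min(h)`. -/
def minSet {V : Type*} (X : AbstractSimplicialComplex V) (h : V ≃ V) : Set V :=
  {v | vdist X v (h v) = translationLength X h}

/-- `γ` is a bi-infinite geodesic. -/
def IsGeodesic {V : Type*} (X : AbstractSimplicialComplex V) (γ : ℤ → V) : Prop :=
  ∀ i j : ℤ, vdist X (γ i) (γ j) = (i - j).natAbs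

/-- `A` is (the vertex set of) an axis of `h`: an `h`-invariant geodesic, regarded as a subset
rather than as a parametrised path. -/
def IsAxis {V : Type*} (X : AbstractSimplicialComplex V) (h : V ≃ V) (A : Set V) : Prop :=
  (∃ γ : ℤ → V, IsGeodesic X γ ∧ Set.range γ = A) ∧ h '' A = A

/-- `Min(h)` is the union of axes: through each of its vertices passes an axis. -/
def MinSetIsUnionOfAxes {V : Type*} (X : AbstractSimplicialComplex V) (h : V ≃ V) : Prop :=
  ∀ x ∈ minSet X h, ∃ A : Set V, IsAxis X h A ∧ x ∈ A

/-! ### The graph of axes -/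

/-- The vertices of the graph of axes: the `h`-invariant geodesics contained in `Min(h)`. -/
def Axes {V : Type*} (X : AbstractSimplicialComplex V) (h : V ≃ V) : Type _ :=
  {A : Set V // IsAxis X h A ∧ A ⊆ minSet X h}

/-- `d_min(A, B)`, the minimum of the distances `d(a, b)` with `a ∈ A`, `b ∈ B`. -/
noncomputable def dMin {V : Type*} (X : AbstractSimplicialComplex V) (A B : Set V) : ℕ :=
  sInf {n | ∃ a ∈ A, ∃ b ∈ B, vdist X a b = n}

theorem dMin_comm {V : Type*} (X : AbstractSimplicialComplex V) (A B : Set V) :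
    dMin X A B = dMin X B A := by
  have key : ∀ A B : Set V, {n | ∃ a ∈ A, ∃ b ∈ B, vdist X a b = n} ⊆
      {n | ∃ a ∈ B, ∃ b ∈ A, vdist X a b = n} := by
    rintro A B n ⟨a, ha, b, hb, rfl⟩
    exact ⟨b, hb, a, ha, SimpleGraph.dist_comm⟩
  unfold dMin
  rw [Set.Subset.antisymm (key A B) (key B A)]

/-- The graph of axes `Y(h)`: distinct axes are adjacent when `d_min ≤ 1`. -/
def axesGraph {V : Type*} (X : AbstractSimplicialComplex V) (h : V ≃ V) :
    SimpleGraph (Axes X h) where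
  Adj A B := A ≠ B ∧ dMin X A.1 B.1 ≤ 1
  symm := ⟨fun A B hAB => ⟨hAB.1.symm, (dMin_comm X B.1 A.1).trans_le hAB.2⟩⟩
  loopless := ⟨fun _ hA => hA.1 rfl⟩

/-! ### Parametrising the axes -/

/-- `γ` is a geodesic parametrisation of the axis `A`, oriented such that `x` precedes `h x` for
every vertex `x` of `A`. -/
def IsOrientedParam {V : Type*} (X : AbstractSimplicialComplex V) (h : V ≃ V) (A : Axes X h)
    (γ : ℤ → V) : Prop :=
  IsGeodesic X γ ∧ Set.range γ = A.1 ∧ ∀ t : ℤ, ∃ s : ℤ, t < s ∧ h (γ t) = γ s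

/-- The vertices of the ascending union of the balls `B_n(γ₀(-n), X)`, `n ≥ 0`. -/
def horoball {V : Type*} (X : AbstractSimplicialComplex V) (γ₀ : ℤ → V) : Set V :=
  {x | ∃ n : ℕ, vdist X (γ₀ (-(n : ℤ))) x ≤ n}

/-- `p` parametrises every axis `A` as an oriented geodesic whose origin `p A 0` is the last vertex
of `A` lying in the union of the balls `B_n(γ₀(-n), X)`. -/
def IsAxesParam {V : Type*} (X : AbstractSimplicialComplex V) (h : V ≃ V) (γ₀ : ℤ → V)
    (p : Axes X h → ℤ → V) : Prop :=
  ∀ A : Axes X h, IsOrientedParam X h A (p A) ∧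
    IsGreatest {t : ℤ | p A t ∈ horoball X γ₀} 0

/-- The map `c : Y(h) × ℤ → Min(h)`, `(γ, t) ↦ γ(t)`. -/
def axesMap {V : Type*} (X : AbstractSimplicialComplex V) (h : V ≃ V) (γ₀ : ℤ → V)
    (p : Axes X h → ℤ → V) (hp : IsAxesParam X h γ₀ p) (x : Axes X h × ℤ) : minSet X h :=
  ⟨p x.1 x.2, x.1.2.2 ((hp x.1).1.2.1 ▸ Set.mem_range_self x.2)⟩

/-- The `ℓ¹` metric on `Y(h) × ℤ`. -/
noncomputable def prodDist {V : Type*} (X : AbstractSimplicialComplex V) (h : V ≃ V)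
    (x y : Axes X h × ℤ) : ℝ :=
  ((axesGraph X h).dist x.1 y.1 : ℝ) + |(x.2 : ℝ) - (y.2 : ℝ)|

/-- The metric on `Min(h)` induced from `X`. -/
noncomputable def minDist {V : Type*} (X : AbstractSimplicialComplex V) (h : V ≃ V)
    (x y : minSet X h) : ℝ :=
  (vdist X x.1 y.1 : ℝ)

/-! ### Quasi-isometries, with respect to given distance functions -/

/-- `f` is a quasi-isometric embedding: distances of images are bounded below and above by affine
functions (of positive, resp. nonnegative, slope) of the distances. -/
def IsQuasiIsometricEmbedding {α β : Type*} (dα : α → α → ℝ) (dβ : β → β → ℝ) (f : α → β) :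
    Prop :=
  ∃ a b c d : ℝ, 0 < a ∧ 0 ≤ c ∧
    ∀ x y, a * dα x y - b ≤ dβ (f x) (f y) ∧ dβ (f x) (f y) ≤ c * dα x y + d

/-- Two maps are close: they are at bounded uniform distance. -/
def AreClose {α β : Type*} (dβ : β → β → ℝ) (f g : α → β) : Prop :=
  ∃ R : ℝ, 0 ≤ R ∧ ∀ x, dβ (f x) (g x) ≤ R

/-- `f` is a quasi-isometry: a quasi-isometric embedding which has a quasi-inverse that is also a
quasi-isometric embedding. -/
def IsQuasiIsometry {α β : Type*} (dα : α → α → ℝ) (dβ : β → β → ℝ) (f : α → β) : Prop :=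
  IsQuasiIsometricEmbedding dα dβ f ∧
  ∃ g : β → α, IsQuasiIsometricEmbedding dβ dα g ∧ AreClose dα (g ∘ f) id ∧
    AreClose dβ (f ∘ g) id

end Systolic

/-! Two facts carry the theorem. The first is that Min(h) is isometrically embedded: any two of its
vertices are joined by a geodesic of X inside Min(h) (`IsBridged.exists_geodesic_min`). The second
is that the Busemann function β of the negative end of γ₀ is integer valued and 1-Lipschitz,
satisfies β(hx) = β(x) + L, and has Ω as its sublevel set β ≤ 0. Along an axis in Min(h) it gains
exactly L in L steps, so it grows with unit speed, and the normalisation by Ω says β(γ(t)) = t.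

Following a geodesic of Min(h) and choosing an axis through each of its vertices gives a walk in
Y(h) of length at most d + 1, while β bounds the difference of parameters by d; hence d_h ≤ 2d + 1.
Conversely, two adjacent axes come within distance 1 at almost equal times, and by h-periodicity
again in every period, so at equal times they stay within 2L + 2. This gives the upper bound.

The embedding of Min(h) is proved by descent. On a geodesic between two vertices of Min(h), a vertex
where the displacement first reaches its maximum can be replaced by one of smaller displacement
(`IsBridged.descend`). This uses three metric properties of the 1-skeleton, collected in
`IsBridged`, and the consequence `edge_clique` in which the base vertex becomes an edge.

These properties come from the local condition by developing the complex sphere by sphere from a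
base vertex. 6-largeness of links makes the construction consistent and the result a covering;
simple connectivity identifies it with X. Levels are then distances, and the triangle and clique
conditions hold by construction. -/

namespace Systolic

-- Developing the complex sphere by sphere

universe u

/-- The adjacency and triangle relations of a complex whose vertex links are flag and have no
induced cycles of length 4 or 5. -/
structure SixLargeSystem (V : Type u) where
  Ad : V → V → Prop
  Tr : V → V → V → Prop
  ad_symm : ∀ {a b}, Ad a b → Ad b a
  tr_swap : ∀ {a b c}, Tr a b c → Tr b a c
  tr_rot : ∀ {a b c}, Tr a b c → Tr b c a
  tr_ad : ∀ {a b c}, Tr a b c → Ad a b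
  ad_ne : ∀ {a b}, Ad a b → a ≠ b
  flag : ∀ {v a b c}, Tr v a b → Tr v b c → Tr v a c → Tr a b c
  four : ∀ {v a b c d}, Tr v a b → Tr v b c → Tr v c d → Tr v d a → a ≠ c → b ≠ d →
    Tr v a c ∨ Tr v b d
  five : ∀ {v a b c d e}, Tr v a b → Tr v b c → Tr v c d → Tr v d e → Tr v e a →
    a ≠ c → a ≠ d → b ≠ d → b ≠ e → c ≠ e →
    Tr v a c ∨ Tr v a d ∨ Tr v b d ∨ Tr v b e ∨ Tr v c e

namespace SixLargeSystem

variable {V : Type u} (C : SixLargeSystem V)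

/-- Two consecutive spheres `T`, `S` of the development of the complex from a base vertex: `E` and
`F` are the adjacencies inside `S` and `T`, and `D` is the adjacency between them. -/
structure Stage where
  S : Type u
  T : Type u
  π : S → V
  ρ : T → V
  E : S → S → Prop
  F : T → T → Prop
  D : S → T → Prop
  E_symm : ∀ {a b}, E a b → E b a
  E_ad : ∀ {a b}, E a b → C.Ad (π a) (π b)
  D_ad : ∀ {a t}, D a t → C.Ad (π a) (ρ t)
  injEE : ∀ {s a b}, E s a → E s b → π a = π b → a = b
  injDD : ∀ {s a b}, D s a → D s b → ρ a = ρ b → a = b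
  injED : ∀ {s a t}, E s a → D s t → π a ≠ ρ t
  fullEE : ∀ {s a b}, E s a → E s b → C.Tr (π s) (π a) (π b) → E a b
  fullED : ∀ {s a t}, E s a → D s t → C.Tr (π s) (π a) (ρ t) → D a t
  fullDD : ∀ {s a b}, D s a → D s b → a ≠ b → F a b ∧ C.Tr (π s) (ρ a) (ρ b)
  tri : ∀ {a b}, E a b → ∃ t, D a t ∧ D b t ∧ C.Tr (π a) (π b) (ρ t)
  -- An edge reaching the inner sphere already has its whole link in the two spheres, so new
  -- vertices attach only along the outer sphere.
  lift : ∀ {s t z}, D s t → C.Tr (π s) (ρ t) z →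
    (∃ s', E s s' ∧ π s' = z) ∨ ∃ t', D s t' ∧ ρ t' = z

namespace Stage

variable {C} (A : Stage C)

/-- `z` is adjacent to the image of `w` and is not yet the image of a neighbour of `w`. -/
def Valid (w : A.S) (z : V) : Prop :=
  C.Ad (A.π w) z ∧ (∀ s, A.E w s → A.π s ≠ z) ∧ ∀ t, A.D w t → A.ρ t ≠ z

variable {A}

theorem Valid.propagate {w v : A.S} {z : V} (hw : A.Valid w z) (e : A.E w v)
    (ht : C.Tr (A.π w) (A.π v) z) : A.Valid v z := by
  refine ⟨C.tr_ad (C.tr_rot ht), fun s hs hz => ?_, fun t hd hz => ?_⟩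
  · subst hz
    exact hw.2.1 s (A.fullEE (A.E_symm e) hs (C.tr_swap ht)) rfl
  · subst hz
    exact hw.2.2 t (A.fullED (A.E_symm e) hd (C.tr_swap ht)) rfl

/-- By `lift` the link of a descending edge is complete, so a missing neighbour cannot lie in it. -/
theorem Valid.not_tr {w : A.S} {z : V} (hw : A.Valid w z) {t : A.T} (hd : A.D w t) :
    ¬ C.Tr (A.π w) (A.ρ t) z := by
  intro h
  rcases A.lift hd h with ⟨s, hs, hz⟩ | ⟨t', ht, hz⟩
  · exact hw.2.1 s hs hz
  · exact hw.2.2 t' ht hz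

/-- This is where 6-largeness enters. With lower vertices p and q common to v, w and to v, x, the
images of z, w, p, q, x form a cycle of length 5 in the link of v, or 4 if p = q. A missing vertex z
is joined to no lower vertex, so every possible diagonal leads to the one from w to x, directly or
through a remaining 4-cycle. -/
theorem Valid.trans {w v x : A.S} {z : V} (hv : A.Valid v z)
    (e : A.E v w) (e' : A.E v x) (t : C.Tr (A.π v) (A.π w) z)
    (t' : C.Tr (A.π v) (A.π x) z) (hne : w ≠ x) :
    A.E w x ∧ C.Tr (A.π w) (A.π x) z := by
  have hπ : A.π w ≠ A.π x := fun h => hne (A.injEE e e' h)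
  have key : ∀ p, A.D v p → C.Tr (A.π v) (A.π w) (A.ρ p) → C.Tr (A.π v) (A.π x) (A.ρ p) →
      C.Tr (A.π v) (A.π w) (A.π x) := by
    intro p hp h1 h2
    rcases C.four (C.tr_swap (C.tr_rot (C.tr_rot t))) h1 (C.tr_swap (C.tr_rot (C.tr_rot h2))) t'
      (fun h => hv.2.2 p hp h.symm) hπ with h | h
    · exact absurd (C.tr_swap (C.tr_rot (C.tr_rot h))) (hv.not_tr hp)
    · exact h
  suffices h : C.Tr (A.π v) (A.π w) (A.π x) from ⟨A.fullEE e e' h, C.flag h t' t⟩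
  obtain ⟨p, hvp, hwp, hp⟩ := A.tri e
  obtain ⟨q, hvq, hxq, hq⟩ := A.tri e'
  by_cases hpq : p = q
  · subst hpq; exact key p hvp hp hq
  have hpq' := (A.fullDD hvp hvq hpq).2
  rcases C.five (C.tr_swap (C.tr_rot (C.tr_rot t))) hp hpq' (C.tr_swap (C.tr_rot (C.tr_rot hq))) t'
    (fun h => hv.2.2 p hvp h.symm) (fun h => hv.2.2 q hvq h.symm) (A.injED e hvq) hπ
    (A.injED e' hvp).symm with h | h | h | h | h
  · exact absurd (C.tr_swap (C.tr_rot (C.tr_rot h))) (hv.not_tr hvp)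
  · exact absurd (C.tr_swap (C.tr_rot (C.tr_rot h))) (hv.not_tr hvq)
  · exact key q hvq h hq
  · exact h
  · exact key p hvp hp (C.tr_swap (C.tr_rot (C.tr_rot h)))

variable (A)

/-- Two valid pairs describe the same vertex of the next sphere. -/
def nextSetoid : Setoid {x : A.S × V // A.Valid x.1 x.2} where
  r x y := x.1.2 = y.1.2 ∧
    (x.1.1 = y.1.1 ∨ A.E x.1.1 y.1.1 ∧ C.Tr (A.π x.1.1) (A.π y.1.1) x.1.2)
  iseqv := by
    refine ⟨fun x => ⟨rfl, Or.inl rfl⟩, ?_, ?_⟩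
    · rintro ⟨⟨w, z⟩, hw⟩ ⟨⟨v, z'⟩, hv⟩ ⟨h, h'⟩
      dsimp only at h h' hw hv ⊢
      subst h
      refine ⟨rfl, ?_⟩
      rcases h' with rfl | ⟨e, t⟩
      · exact Or.inl rfl
      · exact Or.inr ⟨A.E_symm e, C.tr_swap t⟩
    · rintro ⟨⟨w, z⟩, hw⟩ ⟨⟨v, z'⟩, hv⟩ ⟨⟨x, z''⟩, hx⟩ ⟨h, h'⟩ ⟨k, k'⟩
      dsimp only at h h' k k' hw hv hx ⊢
      subst h k
      refine ⟨rfl, ?_⟩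
      rcases h' with rfl | ⟨e, t⟩
      · exact k'
      rcases k' with rfl | ⟨e', t'⟩
      · exact Or.inr ⟨e, t⟩
      by_cases hne : w = x
      · exact Or.inl hne
      · exact Or.inr (hv.trans (A.E_symm e) e' (C.tr_swap t) t' hne)

/-- The vertices of the next sphere. -/
def NextS : Type u := Quotient A.nextSetoid

/-- The image in the complex of a vertex of the next sphere. -/
def nextπ : A.NextS → V := Quotient.lift (fun x => x.1.2) fun _ _ h => h.1

/-- Adjacency between the next sphere and the present one. -/
def nextD (s : A.NextS) (t : A.S) : Prop :=
  ∃ (z : V) (h : A.Valid t z), s = Quotient.mk A.nextSetoid ⟨(t, z), h⟩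

/-- Adjacency in the next sphere. -/
def nextE (s s' : A.NextS) : Prop :=
  ∃ w, A.nextD s w ∧ A.nextD s' w ∧ C.Tr (A.π w) (A.nextπ s) (A.nextπ s')

variable {A}

theorem nextD.valid {s : A.NextS} {t : A.S} (h : A.nextD s t) : A.Valid t (A.nextπ s) := by
  obtain ⟨z, h, rfl⟩ := h
  exact h

/-- By `Valid.trans` the relation between pairs is itself transitive, so equality in the quotient
yields adjacency and not just a chain. -/
theorem nextD.clique {s : A.NextS} {t t' : A.S} (h : A.nextD s t) (h' : A.nextD s t') :
    t = t' ∨ A.E t t' ∧ C.Tr (A.π t) (A.π t') (A.nextπ s) := by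
  obtain ⟨z, h, rfl⟩ := h
  obtain ⟨z', h', e⟩ := h'
  exact (Quotient.exact e).2

theorem nextD.eq {s s' : A.NextS} {t : A.S} (h : A.nextD s t) (h' : A.nextD s' t)
    (e : A.nextπ s = A.nextπ s') : s = s' := by
  obtain ⟨z, h, rfl⟩ := h
  obtain ⟨z', h', rfl⟩ := h'
  exact Quotient.sound (s := A.nextSetoid) ⟨e, Or.inl rfl⟩

theorem nextD.propagate {s : A.NextS} {t t' : A.S} (h : A.nextD s t) (e : A.E t t')
    (ht : C.Tr (A.π t) (A.π t') (A.nextπ s)) : A.nextD s t' := by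
  have hv := h.valid.propagate e ht
  obtain ⟨z, h, rfl⟩ := h
  exact ⟨z, hv, Quotient.sound (s := A.nextSetoid) ⟨rfl, Or.inr ⟨e, ht⟩⟩⟩

theorem Valid.exists_next {t : A.S} {z : V} (h : A.Valid t z) :
    ∃ s, A.nextD s t ∧ A.nextπ s = z :=
  ⟨Quotient.mk A.nextSetoid ⟨(t, z), h⟩, ⟨z, h, rfl⟩, rfl⟩

theorem exists_nextD (s : A.NextS) : ∃ t, A.nextD s t := by
  induction s using Quotient.inductionOn with
  | h x => exact ⟨x.1.1, x.1.2, x.2, rfl⟩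

theorem nextE.symm {s s' : A.NextS} (h : A.nextE s s') : A.nextE s' s := by
  obtain ⟨w, h, h', t⟩ := h
  exact ⟨w, h', h, C.tr_swap (C.tr_rot (C.tr_rot t))⟩

theorem nextE.eq {s a b : A.NextS} (ha : A.nextE s a) (hb : A.nextE s b)
    (e : A.nextπ a = A.nextπ b) : a = b := by
  obtain ⟨w, hsw, haw, tw⟩ := ha
  obtain ⟨v, hsv, hbv, tv⟩ := hb
  rcases hsw.clique hsv with rfl | ⟨hwv, t⟩
  · exact haw.eq hbv e
  · refine (haw.propagate hwv ?_).eq hbv e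
    rw [← e] at tv
    exact C.flag (C.tr_rot (C.tr_rot t)) (C.tr_swap tv) (C.tr_swap tw)

/-- If the edges sa and sb lie over different vertices w and v, then a, w, v, b is a 4-cycle in the
link of s. Either diagonal puts a and b over a common lower vertex, which is the case treated by
`main`. -/
theorem nextE.full {s a b : A.NextS} (ha : A.nextE s a) (hb : A.nextE s b)
    (h : C.Tr (A.nextπ s) (A.nextπ a) (A.nextπ b)) : A.nextE a b := by
  have main : ∀ {a b : A.NextS} {v : A.S}, A.nextE s a → A.nextD s v → A.nextD b v →
      C.Tr (A.π v) (A.nextπ s) (A.nextπ b) → C.Tr (A.nextπ s) (A.nextπ a) (A.nextπ b) →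
      C.Tr (A.nextπ s) (A.nextπ a) (A.π v) → A.nextE a b := by
    intro a b v ha hsv hbv tv h hav
    obtain ⟨w, hsw, haw, tw⟩ := ha
    have hav' : A.nextD a v := by
      rcases hsw.clique hsv with rfl | ⟨hwv, t⟩
      · exact haw
      · exact haw.propagate hwv
          (C.flag (C.tr_rot (C.tr_rot t)) (C.tr_swap (C.tr_rot (C.tr_rot hav))) (C.tr_swap tw))
    exact ⟨v, hav', hbv, C.flag (C.tr_swap (C.tr_rot (C.tr_rot hav))) h (C.tr_swap tv)⟩
  have ha0 := ha
  have hb0 := hb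
  obtain ⟨w, hsw, haw, tw⟩ := ha
  obtain ⟨v, hsv, hbv, tv⟩ := hb
  rcases hsw.clique hsv with rfl | ⟨hwv, t⟩
  · exact main ha0 hsv hbv tv h (C.tr_rot tw)
  · rcases C.four (C.tr_rot tw) (C.tr_rot (C.tr_rot t)) (C.tr_swap tv)
      (C.tr_swap (C.tr_rot (C.tr_rot h))) (haw.valid.2.1 v hwv).symm
      (hbv.valid.2.1 w (A.E_symm hwv)) with h' | h'
    · exact main ha0 hsv hbv tv h h'
    · exact (main hb0 hsw haw tw (C.tr_swap (C.tr_rot (C.tr_rot h)))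
        (C.tr_swap (C.tr_rot (C.tr_rot h')))).symm

variable (A)

/-- The next stage of the development. -/
def next : Stage C where
  S := A.NextS
  T := A.S
  π := A.nextπ
  ρ := A.π
  E := A.nextE
  F := A.E
  D := A.nextD
  E_symm := nextE.symm
  E_ad := fun ⟨_, _, _, t⟩ => C.tr_ad (C.tr_rot t)
  D_ad := fun h => C.ad_symm h.valid.1
  injEE := nextE.eq
  injDD := by
    intro s a b ha hb e
    rcases ha.clique hb with h | h
    · exact h
    · exact absurd e (C.ad_ne (A.E_ad h.1))
  injED := by
    rintro s a t ⟨w, hsw, haw, tw⟩ hst e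
    rcases hsw.clique hst with rfl | ⟨hwt, -⟩
    · exact C.ad_ne haw.valid.1 e.symm
    · exact haw.valid.2.1 t hwt e.symm
  fullEE := nextE.full
  fullED := by
    rintro s a t ⟨w, hsw, haw, tw⟩ hst h
    rcases hsw.clique hst with rfl | ⟨hwt, t'⟩
    · exact haw
    · exact haw.propagate hwt
        (C.flag (C.tr_rot (C.tr_rot t')) (C.tr_swap (C.tr_rot (C.tr_rot h))) (C.tr_swap tw))
  fullDD := by
    intro s a b ha hb hne
    rcases ha.clique hb with h | h
    · exact absurd h hne
    · exact ⟨h.1, C.tr_rot (C.tr_rot h.2)⟩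
  tri := fun ⟨w, h, h', t⟩ => ⟨w, h, h', C.tr_rot t⟩
  -- A vertex z completing the edge st is either missing at t, and then appears in the new sphere,
  -- or an old neighbour of t in the same sphere, over which s then also lies. It cannot be a lower
  -- vertex.
  lift := by
    intro s t z hd h
    by_cases hv : A.Valid t z
    · obtain ⟨s', hs', rfl⟩ := hv.exists_next
      exact Or.inl ⟨s', ⟨t, hd, hs', C.tr_swap h⟩, rfl⟩
    · simp only [Valid, not_and_or, not_forall, not_not] at hv
      rcases hv with hv | ⟨x, hx, rfl⟩ | ⟨x, hx, rfl⟩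
      · exact absurd (C.tr_ad (C.tr_rot h)) hv
      · exact Or.inr ⟨x, hd.propagate hx (C.tr_rot h), rfl⟩
      · exact absurd (C.tr_rot h) (hd.valid.not_tr hx)

/-- The stage consisting of the base vertex. -/
def base (C : SixLargeSystem V) (o : V) : Stage C where
  S := PUnit
  T := PEmpty
  π := fun _ => o
  ρ := PEmpty.elim
  E := fun _ _ => False
  F := fun _ _ => False
  D := fun _ _ => False
  E_symm := id
  E_ad := False.elim
  D_ad := False.elim
  injEE := fun h => h.elim
  injDD := fun h => h.elim
  injED := fun h => h.elim
  fullEE := fun h => h.elim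
  fullED := fun h => h.elim
  fullDD := fun h => h.elim
  tri := False.elim
  lift := fun h => h.elim

end Stage
end SixLargeSystem
end Systolic

/-! ### The development as a covering -/

namespace Systolic
universe u
namespace SixLargeSystem
variable {V : Type u} (C : SixLargeSystem V) (o : V)

/-- The stages of the development from the base vertex `o`. -/
def stages : ℕ → Stage C
  | 0 => Stage.base C o
  | n + 1 => (stages n).next

/-- The vertices of the development. -/
abbrev Cover : Type u := Σ n, (C.stages o n).S

namespace Cover

variable {C o}

/-- The projection of the development to the complex. -/
def proj (x : C.Cover o) : V := (C.stages o x.1).π x.2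

/-- Adjacency in the development. -/
inductive CAdj : C.Cover o → C.Cover o → Prop
  | same {n : ℕ} {a b : (C.stages o n).S} (h : (C.stages o n).E a b) : CAdj ⟨n, a⟩ ⟨n, b⟩
  | up {n : ℕ} {w : (C.stages o n).S} {s : (C.stages o (n + 1)).S}
      (h : (C.stages o n).nextD s w) : CAdj ⟨n, w⟩ ⟨n + 1, s⟩
  | down {n : ℕ} {w : (C.stages o n).S} {s : (C.stages o (n + 1)).S}
      (h : (C.stages o n).nextD s w) : CAdj ⟨n + 1, s⟩ ⟨n, w⟩

theorem CAdj.symm {x y : C.Cover o} (h : CAdj x y) : CAdj y x := by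
  cases h with
  | same h => exact .same ((C.stages o _).E_symm h)
  | up h => exact .down h
  | down h => exact .up h

/-- The lower sphere of a stage, as a part of the development. -/
def lower : ∀ n, (C.stages o n).T → C.Cover o
  | 0, t => PEmpty.elim t
  | n + 1, t => ⟨n, t⟩

theorem proj_lower : ∀ (n : ℕ) (t : (C.stages o n).T), proj (lower n t) = (C.stages o n).ρ t
  | 0, t => PEmpty.elim t
  | _ + 1, _ => rfl

theorem cadj_lower : ∀ {n : ℕ} {s : (C.stages o n).S} {t : (C.stages o n).T},
    (C.stages o n).D s t → CAdj ⟨n, s⟩ (lower n t)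
  | 0, _, t, _ => PEmpty.elim t
  | _ + 1, _, _, h => .down h

theorem cadj_lower_lower : ∀ {n : ℕ} {t t' : (C.stages o n).T},
    (C.stages o n).F t t' → CAdj (lower n t) (lower n t')
  | 0, t, _, _ => PEmpty.elim t
  | _ + 1, _, _, h => .same h

theorem CAdj.cases {n : ℕ} {s : (C.stages o n).S} {y : C.Cover o} (h : CAdj ⟨n, s⟩ y) :
    (∃ b, (C.stages o n).E s b ∧ y = ⟨n, b⟩) ∨
    (∃ t, (C.stages o n).D s t ∧ y = lower n t) ∨
    ∃ v : (C.stages o (n + 1)).S, (C.stages o n).nextD v s ∧ y = ⟨n + 1, v⟩ := by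
  cases h with
  | same h => exact Or.inl ⟨_, h, rfl⟩
  | up h => exact Or.inr (Or.inr ⟨_, h, rfl⟩)
  | down h => exact Or.inr (Or.inl ⟨_, h, rfl⟩)

theorem CAdj.ad {x y : C.Cover o} (h : CAdj x y) : C.Ad (proj x) (proj y) := by
  cases h with
  | same h => exact (C.stages o _).E_ad h
  | up h => exact h.valid.1
  | down h => exact C.ad_symm h.valid.1

/-- Together with `CAdj.unique` and `CAdj.triangle` this is the covering property: edges lift
uniquely, and triangles lift to triangles. -/
theorem exists_lift (x : C.Cover o) {z : V} (h : C.Ad (proj x) z) :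
    ∃ y, CAdj x y ∧ proj y = z := by
  obtain ⟨n, s⟩ := x
  by_cases hv : (C.stages o n).Valid s z
  · obtain ⟨v, hd, rfl⟩ := hv.exists_next
    exact ⟨⟨n + 1, v⟩, .up hd, rfl⟩
  · simp only [Stage.Valid, not_and_or, not_forall, not_not] at hv
    rcases hv with hv | ⟨b, hb, rfl⟩ | ⟨t, ht, rfl⟩
    · exact absurd h hv
    · exact ⟨⟨n, b⟩, .same hb, rfl⟩
    · exact ⟨lower n t, cadj_lower ht, proj_lower n t⟩

theorem CAdj.unique {x a b : C.Cover o} (ha : CAdj x a) (hb : CAdj x b)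
    (e : proj a = proj b) : a = b := by
  obtain ⟨n, s⟩ := x
  rcases ha.cases with ⟨a, ka, rfl⟩ | ⟨a, ka, rfl⟩ | ⟨a, ka, rfl⟩ <;>
  rcases hb.cases with ⟨b, kb, rfl⟩ | ⟨b, kb, rfl⟩ | ⟨b, kb, rfl⟩ <;>
  try simp only [proj_lower] at e
  · rw [(C.stages o n).injEE ka kb e]
  · exact absurd e ((C.stages o n).injED ka kb)
  · exact absurd e (kb.valid.2.1 a ka)
  · exact absurd e.symm ((C.stages o n).injED kb ka)
  · rw [(C.stages o n).injDD ka kb e]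
  · exact absurd e (kb.valid.2.2 a ka)
  · exact absurd e.symm (ka.valid.2.1 b kb)
  · exact absurd e.symm (ka.valid.2.2 b kb)
  · rw [ka.eq kb e]

theorem CAdj.triangle {x a b : C.Cover o} (ha : CAdj x a) (hb : CAdj x b)
    (h : C.Tr (proj x) (proj a) (proj b)) : CAdj a b := by
  have h' : C.Tr (proj x) (proj b) (proj a) := C.tr_swap (C.tr_rot (C.tr_rot h))
  obtain ⟨n, s⟩ := x
  have hne : a ≠ b := fun e => C.ad_ne (C.tr_ad (C.tr_rot h)) (congrArg proj e)
  rcases ha.cases with ⟨a, ka, rfl⟩ | ⟨a, ka, rfl⟩ | ⟨a, ka, rfl⟩ <;>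
  rcases hb.cases with ⟨b, kb, rfl⟩ | ⟨b, kb, rfl⟩ | ⟨b, kb, rfl⟩ <;>
  try simp only [proj_lower] at h h'
  · exact .same ((C.stages o n).fullEE ka kb h)
  · exact cadj_lower ((C.stages o n).fullED ka kb h)
  · exact .up (kb.propagate ka h)
  · exact (cadj_lower ((C.stages o n).fullED kb ka h')).symm
  · exact cadj_lower_lower ((C.stages o n).fullDD ka kb fun e => hne (by rw [e])).1
  · exact absurd h (kb.valid.not_tr ka)
  · exact .down (ka.propagate kb h')
  · exact absurd h' (ka.valid.not_tr kb)
  · exact .same ⟨s, ka, kb, h⟩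

theorem cadj_triangle_of_same {n : ℕ} {a b : (C.stages o (n + 1)).S}
    (h : CAdj (⟨n + 1, a⟩ : C.Cover o) ⟨n + 1, b⟩) :
    ∃ w : (C.stages o n).S, CAdj (⟨n + 1, a⟩ : C.Cover o) ⟨n, w⟩ ∧
      CAdj (⟨n + 1, b⟩ : C.Cover o) ⟨n, w⟩ ∧
      C.Tr (proj (⟨n + 1, a⟩ : C.Cover o)) (proj (⟨n + 1, b⟩ : C.Cover o))
        (proj (⟨n, w⟩ : C.Cover o)) := by
  cases h with
  | same h =>
    obtain ⟨w, h1, h2, h3⟩ := h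
    exact ⟨w, .down h1, .down h2, C.tr_rot h3⟩

theorem cadj_clique_of_lower {n : ℕ} {a : (C.stages o (n + 1)).S} {b c : (C.stages o n).S}
    (hb : CAdj (⟨n + 1, a⟩ : C.Cover o) ⟨n, b⟩) (hc : CAdj (⟨n + 1, a⟩ : C.Cover o) ⟨n, c⟩) :
    b = c ∨ C.Tr (proj (⟨n + 1, a⟩ : C.Cover o)) (proj (⟨n, b⟩ : C.Cover o))
      (proj (⟨n, c⟩ : C.Cover o)) := by
  cases hb with
  | down hb =>
    cases hc with
    | down hc =>
      rcases hb.clique hc with h | h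
      · exact Or.inl h
      · exact Or.inr (C.tr_rot (C.tr_rot h.2))

theorem exists_cadj_lower {n : ℕ} (a : (C.stages o (n + 1)).S) :
    ∃ b : (C.stages o n).S, CAdj (⟨n + 1, a⟩ : C.Cover o) ⟨n, b⟩ := by
  obtain ⟨t, ht⟩ := Stage.exists_nextD a
  exact ⟨t, .down ht⟩

theorem CAdj.level_le {x y : C.Cover o} (h : CAdj x y) : y.1 ≤ x.1 + 1 := by
  cases h <;> dsimp only <;> omega

end Cover
end SixLargeSystem
end Systolic

/-! ### Systolic complexes as six-large systems -/

namespace Systolic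
universe u
variable {V : Type u}

/-- Three distinct vertices in a common simplex. -/
def IsTriangle (K : PreAbstractSimplicialComplex V) (a b c : V) : Prop :=
  a ≠ b ∧ b ≠ c ∧ a ≠ c ∧ ∃ s ∈ K.faces, a ∈ s ∧ b ∈ s ∧ c ∈ s

theorem skeleton_link_adj {K : PreAbstractSimplicialComplex V} {v a b : V} :
    (skeleton (link K {v})).Adj a b ↔ IsTriangle K v a b := by
  classical
  constructor
  · rintro ⟨hab, s, ⟨-, hd, ρ, hρ, hv, hs⟩, ha, hb⟩
    rw [Finset.disjoint_singleton_left] at hd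
    refine ⟨?_, hab, ?_, ρ, hρ, hv (Finset.mem_singleton_self v), hs ha, hs hb⟩ <;>
    · rintro rfl
      exact hd ‹_›
  · rintro ⟨hva, hab, hvb, s, hs, hv, ha, hb⟩
    refine ⟨hab, {a, b}, ⟨⟨a, by simp⟩, by simp [hva, hvb], s, hs, by simpa using hv, ?_⟩,
      by simp, by simp⟩
    intro x hx
    simp only [Finset.mem_insert, Finset.mem_singleton] at hx
    rcases hx with rfl | rfl <;> assumption

theorem IsTriangle.swap {K : PreAbstractSimplicialComplex V} {a b c : V} (h : IsTriangle K a b c) :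
    IsTriangle K b a c := by
  obtain ⟨h1, h2, h3, s, hs, ha, hb, hc⟩ := h
  exact ⟨h1.symm, h3, h2, s, hs, hb, ha, hc⟩

theorem IsTriangle.rot {K : PreAbstractSimplicialComplex V} {a b c : V} (h : IsTriangle K a b c) :
    IsTriangle K b c a := by
  obtain ⟨h1, h2, h3, s, hs, ha, hb, hc⟩ := h
  exact ⟨h2, h3.symm, h1.symm, s, hs, hb, hc, ha⟩

theorem isTriangle_flag {K : PreAbstractSimplicialComplex V} {v a b c : V}
    (hf : IsFlag (link K {v})) (h1 : IsTriangle K v a b) (h2 : IsTriangle K v b c)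
    (h3 : IsTriangle K v a c) : IsTriangle K a b c := by
  classical
  have key : ∀ {x y}, IsTriangle K v x y → {x} ∈ (link K {v}).faces := by
    intro x y h
    obtain ⟨hvx, hxy, hvy, s, hs, hv, hx, hy⟩ := h
    exact ⟨by simp, by simpa using hvx, s, hs, by simpa using hv, by simpa using hx⟩
  have h := hf {a, b, c} ⟨a, by simp⟩ (by
      intro x hx
      simp only [Finset.mem_insert, Finset.mem_singleton] at hx
      rcases hx with rfl | rfl | rfl
      · exact key h1
      · exact key h2
      · exact key (h3.rot.swap.rot.rot)) (by
      intro x hx y hy hxy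
      rw [skeleton_link_adj]
      simp only [Finset.mem_insert, Finset.mem_singleton] at hx hy
      have sw : ∀ {x y}, IsTriangle K v x y → IsTriangle K v y x := fun h => h.rot.rot.swap
      rcases hx with rfl | rfl | rfl <;> rcases hy with rfl | rfl | rfl <;>
        first | exact absurd rfl hxy | assumption | exact sw ‹_›)
  obtain ⟨-, -, ρ, hρ, -, hs⟩ := h
  exact ⟨h1.2.1, h2.2.1, h3.2.1, ρ, hρ, hs (by simp), hs (by simp), hs (by simp)⟩

theorem IsLarge.four {K : PreAbstractSimplicialComplex V} (hK : IsLarge 6 K) {a b c d : V}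
    (hab : (skeleton K).Adj a b) (hbc : (skeleton K).Adj b c) (hcd : (skeleton K).Adj c d)
    (hda : (skeleton K).Adj d a) (hac : a ≠ c) (hbd : b ≠ d) :
    (skeleton K).Adj a c ∨ (skeleton K).Adj b d := by
  have h1 := hab.ne
  have h2 := hbc.ne
  have h3 := hcd.ne
  have h4 := hda.ne
  obtain ⟨i, j, hij, hji, h⟩ := hK.2 4 le_rfl (by norm_num) (![a, b, c, d] : Fin 4 → V) (by
      intro (i : Fin 4) (j : Fin 4) h
      fin_cases i <;> fin_cases j <;> first | rfl | simp_all) (by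
      intro (i : Fin 4)
      fin_cases i
      exacts [hab, hbc, hcd, hda])
  change Fin 4 at i j
  fin_cases i <;> fin_cases j <;>
    first
    | exact absurd h (SimpleGraph.irrefl _)
    | exact absurd rfl hij
    | exact absurd rfl hji
    | exact Or.inl h
    | exact Or.inl h.symm
    | exact Or.inr h
    | exact Or.inr h.symm

theorem IsLarge.five {K : PreAbstractSimplicialComplex V} (hK : IsLarge 6 K) {a b c d e : V}
    (hab : (skeleton K).Adj a b) (hbc : (skeleton K).Adj b c) (hcd : (skeleton K).Adj c d)
    (hde : (skeleton K).Adj d e) (hea : (skeleton K).Adj e a) (hac : a ≠ c) (had : a ≠ d)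
    (hbd : b ≠ d) (hbe : b ≠ e) (hce : c ≠ e) :
    (skeleton K).Adj a c ∨ (skeleton K).Adj a d ∨ (skeleton K).Adj b d ∨ (skeleton K).Adj b e ∨
      (skeleton K).Adj c e := by
  have h1 := hab.ne
  have h2 := hbc.ne
  have h3 := hcd.ne
  have h4 := hde.ne
  have h5 := hea.ne
  obtain ⟨i, j, hij, hji, h⟩ := hK.2 5 (by norm_num) (by norm_num)
    (![a, b, c, d, e] : Fin 5 → V) (by
      intro (i : Fin 5) (j : Fin 5) h
      fin_cases i <;> fin_cases j <;> first | rfl | simp_all) (by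
      intro (i : Fin 5)
      fin_cases i
      exacts [hab, hbc, hcd, hde, hea])
  change Fin 5 at i j
  fin_cases i <;> fin_cases j <;>
    first
    | exact absurd h (SimpleGraph.irrefl _)
    | exact absurd rfl hij
    | exact absurd rfl hji
    | exact Or.inl h
    | exact Or.inl h.symm
    | exact Or.inr (Or.inl h)
    | exact Or.inr (Or.inl h.symm)
    | exact Or.inr (Or.inr (Or.inl h))
    | exact Or.inr (Or.inr (Or.inl h.symm))
    | exact Or.inr (Or.inr (Or.inr (Or.inl h)))
    | exact Or.inr (Or.inr (Or.inr (Or.inl h.symm)))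
    | exact Or.inr (Or.inr (Or.inr (Or.inr h)))
    | exact Or.inr (Or.inr (Or.inr (Or.inr h.symm)))

/-- The adjacency and triangle relations of a systolic complex. -/
def IsSystolic.toSixLargeSystem {X : AbstractSimplicialComplex V} (hX : IsSystolic X) :
    SixLargeSystem V where
  Ad := (skeleton X.toPreAbstractSimplicialComplex).Adj
  Tr := IsTriangle X.toPreAbstractSimplicialComplex
  ad_symm := fun h => h.symm
  tr_swap := IsTriangle.swap
  tr_rot := IsTriangle.rot
  tr_ad := fun ⟨h, _, _, s, hs, ha, hb, _⟩ => ⟨h, s, hs, ha, hb⟩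
  ad_ne := fun h => h.ne
  flag := isTriangle_flag (hX.link_large _ (X.singleton_mem _)).1
  four := by
    intro v a b c d
    simp only [← skeleton_link_adj]
    exact (hX.link_large _ (X.singleton_mem v)).four
  five := by
    intro v a b c d e
    simp only [← skeleton_link_adj]
    exact (hX.link_large _ (X.singleton_mem v)).five

/-! ### Path lifting, and the development identified with the complex -/

open SixLargeSystem SixLargeSystem.Cover

/-- The lift of the walk `p` starting at `a` ends at `b`. -/
def LiftsTo {X : AbstractSimplicialComplex V} {hX : IsSystolic X} {o : V} :
    ∀ {u v : V}, (skeleton X.toPreAbstractSimplicialComplex).Walk u v →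
      hX.toSixLargeSystem.Cover o → hX.toSixLargeSystem.Cover o → Prop
  | _, _, .nil, a, b => a = b
  | _, _, .cons (v := v) _ p, a, b => ∃ c, CAdj a c ∧ proj c = v ∧ LiftsTo p c b

section lifting

variable {X : AbstractSimplicialComplex V} {hX : IsSystolic X} {o : V}

theorem LiftsTo.append {u v w : V} {p : (skeleton X.toPreAbstractSimplicialComplex).Walk u v}
    {q : (skeleton X.toPreAbstractSimplicialComplex).Walk v w}
    {a b c : hX.toSixLargeSystem.Cover o} (h : LiftsTo p a b) (h' : LiftsTo q b c) :
    LiftsTo (p.append q) a c := by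
  induction p generalizing a with
  | nil => cases h; exact h'
  | cons e p ih =>
    obtain ⟨d, hd, hd', h⟩ := h
    exact ⟨d, hd, hd', ih h h'⟩

theorem LiftsTo.homotopic {u v : V} {p q : (skeleton X.toPreAbstractSimplicialComplex).Walk u v}
    (H : EdgeHomotopic X.toPreAbstractSimplicialComplex p q)
    {a b : hX.toSixLargeSystem.Cover o} (ha : proj a = u) : LiftsTo p a b ↔ LiftsTo q a b := by
  induction H generalizing a with
  | refl p => exact Iff.rfl
  | symm _ ih => exact (ih ha).symm
  | trans _ _ ih ih' => exact (ih ha).trans (ih' ha)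
  | cons e _ ih =>
    constructor <;>
    · rintro ⟨c, hc, hc', h⟩
      exact ⟨c, hc, hc', by first | exact (ih hc').1 h | exact (ih hc').2 h⟩
  | backtrack e e' p =>
    constructor
    · rintro ⟨c, hc, hc', d, hd, hd', h⟩
      obtain rfl : a = d := hc.symm.unique hd (ha.trans hd'.symm)
      exact h
    · intro h
      subst ha
      obtain ⟨c, hc, hc'⟩ := exists_lift a (C := hX.toSixLargeSystem) e
      exact ⟨c, hc, hc', a, hc.symm, rfl, h⟩
  | triangle s hs hu hv hw e e' e'' p =>
    subst ha
    constructor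
    · rintro ⟨c, hc, rfl, d, hd, rfl, h⟩
      exact ⟨d, hc.symm.triangle hd
        ⟨e.ne.symm, e''.ne, e'.ne, s, hs, hv, hu, hw⟩, rfl, h⟩
    · rintro ⟨d, hd, rfl, h⟩
      obtain ⟨c, hc, rfl⟩ := exists_lift a (C := hX.toSixLargeSystem) e
      exact ⟨c, hc, rfl, d, hc.triangle hd ⟨e.ne, e'.ne, e''.ne, s, hs, hu, hv, hw⟩, rfl, h⟩

/-- The base point of the development. -/
def coverBase (hX : IsSystolic X) (o : V) : hX.toSixLargeSystem.Cover o := ⟨0, PUnit.unit⟩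

theorem exists_walk_to (n : ℕ) (a : (hX.toSixLargeSystem.stages o n).S) :
    ∃ p : (skeleton X.toPreAbstractSimplicialComplex).Walk o
        (proj (⟨n, a⟩ : hX.toSixLargeSystem.Cover o)),
      p.length = n ∧ LiftsTo p (coverBase hX o) ⟨n, a⟩ ∧ LiftsTo p.reverse ⟨n, a⟩ (coverBase hX o) := by
  induction n with
  | zero => exact ⟨.nil, rfl, rfl, rfl⟩
  | succ n ih =>
    obtain ⟨b, hb⟩ := exists_cadj_lower a
    obtain ⟨p, hp, h, h'⟩ := ih b
    have e : (skeleton X.toPreAbstractSimplicialComplex).Adj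
        (proj (⟨n, b⟩ : hX.toSixLargeSystem.Cover o)) (proj (⟨n + 1, a⟩ : hX.toSixLargeSystem.Cover o)) :=
      hb.symm.ad
    refine ⟨p.concat e, by rw [SimpleGraph.Walk.length_concat, hp], ?_, ?_⟩
    · rw [SimpleGraph.Walk.concat_eq_append]
      exact h.append ⟨_, hb.symm, rfl, rfl⟩
    · rw [SimpleGraph.Walk.reverse_concat]
      exact ⟨_, hb, rfl, h'⟩

/-- Going from a down to the base point and up to b projects to a loop. The loop is null-homotopic,
so its lift closes up. -/
theorem proj_injective : Function.Injective (proj : hX.toSixLargeSystem.Cover o → V) := by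
  intro a b hab
  obtain ⟨p, -, hp, hp'⟩ := exists_walk_to (hX := hX) a.1 a.2
  obtain ⟨q, -, hq, hq'⟩ := exists_walk_to (hX := hX) b.1 b.2
  have key : ∀ {z : V} (q : (skeleton X.toPreAbstractSimplicialComplex).Walk o z)
      (_ : z = proj a), LiftsTo q (coverBase hX o) b → LiftsTo q.reverse b (coverBase hX o) →
      a = b := by
    rintro z q rfl hq hq'
    have H := hX.simplyConnected _ (p.reverse.append q)
    exact (LiftsTo.homotopic H rfl).1 (hp'.append hq)
  exact key q hab.symm hq hq'

theorem proj_surjective : Function.Surjective (proj : hX.toSixLargeSystem.Cover o → V) := by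
  intro z
  obtain ⟨p⟩ := hX.connected.preconnected o z
  have key : ∀ {u v : V} (p : (skeleton X.toPreAbstractSimplicialComplex).Walk u v)
      (a : hX.toSixLargeSystem.Cover o), proj a = u → ∃ b : hX.toSixLargeSystem.Cover o, proj b = v := by
    intro u v p
    induction p with
    | nil => exact fun a ha => ⟨a, ha⟩
    | cons e p ih =>
      rintro a rfl
      obtain ⟨c, -, hc⟩ := exists_lift a (C := hX.toSixLargeSystem) e
      exact ih c hc
  exact key p (coverBase hX o) rfl

theorem cadj_iff {a b : hX.toSixLargeSystem.Cover o} :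
    CAdj a b ↔ (skeleton X.toPreAbstractSimplicialComplex).Adj (proj a) (proj b) := by
  refine ⟨fun h => h.ad, fun h => ?_⟩
  obtain ⟨c, hc, e⟩ := exists_lift a (C := hX.toSixLargeSystem) h
  rwa [← proj_injective e]

/-- Each vertex descends to the base point in as many steps as its level; conversely the lift of a
walk changes level by at most one per edge. -/
theorem vdist_proj (a : hX.toSixLargeSystem.Cover o) : vdist X o (proj a) = a.1 := by
  apply le_antisymm
  · obtain ⟨p, hp, -⟩ := exists_walk_to (hX := hX) a.1 a.2
    exact (SimpleGraph.dist_le p).trans hp.le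
  · obtain ⟨p, hp⟩ := hX.connected.exists_walk_length_eq_dist o (proj a)
    have key : ∀ {u v : V} (p : (skeleton X.toPreAbstractSimplicialComplex).Walk u v)
        (a b : hX.toSixLargeSystem.Cover o), proj a = u → proj b = v → b.1 ≤ a.1 + p.length := by
      intro u v p
      induction p with
      | nil =>
        rintro a b rfl hb
        rw [proj_injective hb]
        simp
      | cons e p ih =>
        rintro a b rfl rfl
        obtain ⟨c, hc, rfl⟩ := exists_lift a (C := hX.toSixLargeSystem) e
        have h1 := ih c b rfl rfl
        have h2 := hc.level_le
        rw [SimpleGraph.Walk.length_cons]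
        omega
    have := key p (coverBase hX o) a rfl rfl
    rw [hp] at this
    simpa [coverBase, vdist] using this

end lifting

section

variable {X : AbstractSimplicialComplex V}

/-- Adjacent vertices at equal distance from `o` span a triangle with a vertex closer to `o`. -/
theorem IsSystolic.triangle_condition (hX : IsSystolic X) {o u w : V} {m : ℕ}
    (hu : vdist X o u = m + 1) (hw : vdist X o w = m + 1)
    (h : (skeleton X.toPreAbstractSimplicialComplex).Adj u w) :
    ∃ p, vdist X o p = m ∧ IsTriangle X.toPreAbstractSimplicialComplex u w p := by
  obtain ⟨⟨n, a⟩, rfl⟩ := proj_surjective (hX := hX) (o := o) u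
  obtain ⟨⟨k, b⟩, rfl⟩ := proj_surjective (hX := hX) (o := o) w
  rw [vdist_proj] at hu hw
  dsimp only at hu hw
  subst hu hw
  obtain ⟨c, -, -, hc⟩ := cadj_triangle_of_same (cadj_iff.2 h)
  exact ⟨_, vdist_proj _, hc⟩

/-- The neighbours of `v` that are closer to `o` form a simplex with `v`. -/
theorem IsSystolic.clique_condition (hX : IsSystolic X) {o v p r : V} {m : ℕ}
    (hv : vdist X o v = m + 1) (hp : vdist X o p = m) (hr : vdist X o r = m)
    (hvp : (skeleton X.toPreAbstractSimplicialComplex).Adj v p)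
    (hvr : (skeleton X.toPreAbstractSimplicialComplex).Adj v r) :
    p = r ∨ IsTriangle X.toPreAbstractSimplicialComplex v p r := by
  obtain ⟨⟨n, a⟩, rfl⟩ := proj_surjective (hX := hX) (o := o) v
  obtain ⟨⟨k, b⟩, rfl⟩ := proj_surjective (hX := hX) (o := o) p
  obtain ⟨⟨l, c⟩, rfl⟩ := proj_surjective (hX := hX) (o := o) r
  rw [vdist_proj] at hv hp hr
  dsimp only at hv hp hr
  subst hp hr hv
  rcases cadj_clique_of_lower (cadj_iff.2 hvp) (cadj_iff.2 hvr) with h | h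
  · exact Or.inl (by rw [h])
  · exact Or.inr h

end

end Systolic

/-! ### Metric conditions on the 1-skeleton -/

namespace Systolic
universe u
variable {V : Type u}

/-- The metric properties of the 1-skeleton of a systolic complex: the triangle condition, the
clique condition on neighbours closer to a base vertex, and chords of pentagons. -/
structure IsBridged (G : SimpleGraph V) : Prop where
  connected : G.Connected
  tri : ∀ {o u w : V} {m : ℕ}, G.dist o u = m + 1 → G.dist o w = m + 1 → G.Adj u w →
    ∃ p, G.dist o p = m ∧ G.Adj p u ∧ G.Adj p w
  clique : ∀ {o v p r : V} {m : ℕ}, G.dist o v = m + 1 → G.dist o p = m → G.dist o r = m →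
    G.Adj v p → G.Adj v r → p = r ∨ G.Adj p r
  five : ∀ {a b c d e : V}, G.Adj a b → G.Adj b c → G.Adj c d → G.Adj d e → G.Adj e a →
    a ≠ c → a ≠ d → b ≠ d → b ≠ e → c ≠ e →
    G.Adj a c ∨ G.Adj a d ∨ G.Adj b d ∨ G.Adj b e ∨ G.Adj c e

theorem IsTriangle.adj {K : PreAbstractSimplicialComplex V} {a b c : V} (h : IsTriangle K a b c) :
    (skeleton K).Adj a b :=
  let ⟨h, _, _, s, hs, ha, hb, _⟩ := h
  ⟨h, s, hs, ha, hb⟩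

theorem dist_eq_two_of_adj {G : SimpleGraph V} (hG : G.Connected) {a b c : V} (hab : G.Adj a b)
    (hbc : G.Adj b c) (hne : a ≠ c) (hac : ¬ G.Adj a c) : G.dist a c = 2 := by
  have h1 := hG.one_lt_dist_of_ne_of_not_adj hne hac
  have h2 := hG.dist_triangle (u := a) (v := b) (w := c)
  have h3 := SimpleGraph.dist_eq_one_iff_adj.2 hab
  have h4 := SimpleGraph.dist_eq_one_iff_adj.2 hbc
  omega

theorem IsSystolic.isBridged {X : AbstractSimplicialComplex V} (hX : IsSystolic X) :
    IsBridged (skeleton X.toPreAbstractSimplicialComplex) where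
  connected := hX.connected
  tri := by
    intro o u w m hu hw h
    obtain ⟨p, hp, ht⟩ := hX.triangle_condition hu hw h
    exact ⟨p, hp, ht.rot.rot.adj, ht.rot.adj.symm⟩
  clique := by
    intro o v p r m hv hp hr hvp hvr
    exact (hX.clique_condition hv hp hr hvp hvr).imp_right fun h => h.rot.adj
  five := by
    intro a b c d e hab hbc hcd hde hea hac had hbd hbe hce
    -- Without diagonals, c and d have distance 2 from a, so they have a common neighbour p adjacent
    -- to a. The clique condition makes p adjacent to b and e too, and the pentagon lies in the link
    -- of p.
    by_contra hcon
    simp only [not_or] at hcon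
    obtain ⟨nac, nad, nbd, nbe, nce⟩ := hcon
    obtain ⟨p, hp, ht⟩ := hX.triangle_condition (o := a) (m := 1)
      (dist_eq_two_of_adj hX.connected hab hbc hac nac)
      (dist_eq_two_of_adj hX.connected hea.symm hde.symm had nad) hcd
    have hap := SimpleGraph.dist_eq_one_iff_adj.1 hp
    have hbp : b ≠ p := by rintro rfl; exact nbd ht.rot.adj.symm
    have hep : e ≠ p := by rintro rfl; exact nce ht.rot.rot.adj.symm
    have tb : IsTriangle X.toPreAbstractSimplicialComplex c b p :=
      (hX.clique_condition (o := a) (m := 1)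
        (dist_eq_two_of_adj hX.connected hab hbc hac nac) (SimpleGraph.dist_eq_one_iff_adj.2 hab) hp
        hbc.symm ht.rot.rot.adj.symm).resolve_left hbp
    have te : IsTriangle X.toPreAbstractSimplicialComplex d e p :=
      (hX.clique_condition (o := a) (m := 1)
        (dist_eq_two_of_adj hX.connected hea.symm hde.symm had nad)
        (SimpleGraph.dist_eq_one_iff_adj.2 hea.symm) hp
        hde ht.rot.adj).resolve_left hep
    -- At level 1 the triangle condition can only return a itself, so pairwise adjacency with a
    -- gives an actual 2-simplex.
    have base : ∀ {x}, (skeleton X.toPreAbstractSimplicialComplex).Adj a x →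
        (skeleton X.toPreAbstractSimplicialComplex).Adj x p →
        IsTriangle X.toPreAbstractSimplicialComplex x p a := by
      intro x hx hxp
      obtain ⟨q, hq, t⟩ := hX.triangle_condition (o := a) (m := 0)
        (SimpleGraph.dist_eq_one_iff_adj.2 hx) hp hxp
      obtain rfl := (hX.connected.dist_eq_zero_iff).1 hq
      exact t
    have hab' := base hab tb.rot.adj
    have hea' := base hea.symm te.rot.adj
    have hlarge := (hX.link_large _ (X.singleton_mem p)).five
      (skeleton_link_adj.2 hab'.rot) (skeleton_link_adj.2 tb.swap.rot.rot)
      (skeleton_link_adj.2 ht.rot.rot) (skeleton_link_adj.2 te.rot.rot)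
      (skeleton_link_adj.2 hea'.swap) hac had hbd hbe hce
    simp only [skeleton_link_adj] at hlarge
    rcases hlarge with h | h | h | h | h
    exacts [nac h.rot.adj, nad h.rot.adj, nbd h.rot.adj, nbe h.rot.adj, nce h.rot.adj]

namespace IsBridged

variable {G : SimpleGraph V} (hG : IsBridged G)
include hG

theorem le_left {a b : V} (h : G.Adj a b) (c : V) : G.dist a c ≤ G.dist b c + 1 := by
  have h1 := hG.connected.dist_triangle (u := a) (v := b) (w := c)
  have h3 := SimpleGraph.dist_eq_one_iff_adj.2 h
  omega

theorem le_right {a b : V} (h : G.Adj a b) (c : V) : G.dist c a ≤ G.dist c b + 1 := by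
  rw [G.dist_comm (u := c), G.dist_comm (u := c)]
  exact hG.le_left h c

theorem tri_right {o u w : V} {m : ℕ} (hu : G.dist u o = m + 1) (hw : G.dist w o = m + 1)
    (h : G.Adj u w) : ∃ p, G.dist p o = m ∧ G.Adj p u ∧ G.Adj p w := by
  simp only [G.dist_comm (v := o)] at hu hw ⊢
  exact hG.tri hu hw h

theorem clique_right {o v p r : V} {m : ℕ} (hv : G.dist v o = m + 1) (hp : G.dist p o = m)
    (hr : G.dist r o = m) (hvp : G.Adj v p) (hvr : G.Adj v r) : p = r ∨ G.Adj p r := by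
  simp only [G.dist_comm (v := o)] at hv hp hr
  exact hG.clique hv hp hr hvp hvr

theorem exists_closer {v o : V} {m : ℕ} (h : G.dist v o = m + 1) :
    ∃ p, G.Adj v p ∧ G.dist p o = m := by
  obtain ⟨p, hp⟩ := hG.connected.exists_walk_length_eq_dist v o
  cases p with
  | nil => simp at h
  | cons e p =>
    refine ⟨_, e, ?_⟩
    have h1 := SimpleGraph.dist_le p
    have h2 := hG.le_left e o
    rw [SimpleGraph.Walk.length_cons] at hp
    omega

theorem exists_closer_right {o v : V} {m : ℕ} (h : G.dist o v = m + 1) :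
    ∃ p, G.Adj v p ∧ G.dist o p = m := by
  rw [G.dist_comm] at h
  obtain ⟨p, hp, h⟩ := hG.exists_closer h
  exact ⟨p, hp, by rw [G.dist_comm, h]⟩

theorem four {a b c d : V} (hab : G.Adj a b) (hbc : G.Adj b c) (hcd : G.Adj c d)
    (hda : G.Adj d a) (hac : a ≠ c) (nac : ¬ G.Adj a c) : b = d ∨ G.Adj b d :=
  hG.clique (o := a) (m := 1) (dist_eq_two_of_adj hG.connected hab hbc hac nac)
    (SimpleGraph.dist_eq_one_iff_adj.2 hab) (SimpleGraph.dist_eq_one_iff_adj.2 hda.symm)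
    hbc.symm hcd

/-- In a quadrilateral with two opposite sides of length 1 and two of length `k + 1` not both
diagonals have length `k + 2`. -/
theorem quadrilateral {a a' b b' : V} {k : ℕ} (ha : G.Adj a a') (hb : G.Adj b b')
    (h1 : G.dist a b = k + 1) (h2 : G.dist a' b' = k + 1) (h3 : G.dist a b' = k + 2)
    (h4 : G.dist a' b = k + 2) : False := by
  -- Seen from b', both g and a' are neighbours of a one step closer, so they agree or are adjacent;
  -- this makes a' too close to b.
  obtain ⟨g, hg, hgb⟩ := hG.exists_closer h1
  have h5 := hG.le_right hb.symm g
  have h6 := hG.le_left hg b'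
  have h7 : g = a' ∨ G.Adj g a' :=
    hG.clique_right (o := b') (m := k + 1) h3 (by omega) h2 hg ha
  rcases h7 with rfl | h7
  · omega
  · have := hG.le_left h7.symm b
    omega

/-- The neighbours of `v` which are closer to an edge than `v` form a clique. -/
theorem edge_clique {M : ℕ} : ∀ {a b v p r : V}, G.Adj a b → G.Adj v p → G.Adj v r →
    G.dist v a = M + 1 → G.dist v b = M + 1 → G.dist p a = M → G.dist r b = M →
    p = r ∨ G.Adj p r := by
  induction M with
  | zero =>
    intro a b v p r hab _ _ _ _ hp hr
    rw [hG.connected.dist_eq_zero_iff] at hp hr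
    subst hp hr
    exact Or.inr hab
  | succ M ih =>
    intro a b v p r hab hvp hvr hva hvb hpa hrb
    have b1 := hG.le_right hab r
    have b2 := hG.le_left hvr a
    have b3 := hG.le_right hab.symm p
    have b4 := hG.le_left hvp b
    by_cases h1 : G.dist r a = M + 1
    · exact hG.clique_right hva hpa h1 hvp hvr
    by_cases h2 : G.dist p b = M + 1
    · exact hG.clique_right hvb h2 hrb hvp hvr
    -- Now p is closer only to a and r only to b. The vertex s turns out to be closer to both, and
    -- the induction is applied at s.
    obtain ⟨s, hsa, hsv, hsr⟩ := hG.tri_right (o := a) (m := M + 1) hva (by omega) hvr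
    have b5 := hG.le_right hab.symm s
    have b6 := hG.le_left hsv.symm b
    by_cases h3 : G.dist s b = M + 2
    · exact (hG.quadrilateral hsr hab hsa hrb h3 (by omega)).elim
    rcases hG.clique_right hva hpa hsa hvp hsv.symm with rfl | hps
    · exact Or.inr hsr
    obtain ⟨e, hea, hep, hes⟩ := hG.tri_right hpa hsa hps
    obtain ⟨g, hgb, hgs, hgr⟩ := hG.tri_right (o := b) (m := M) (by omega) hrb hsr
    have c1 := hG.le_left hgr.symm a
    have c2 := hG.le_left hep.symm b
    have c3 := hG.le_left hgs.symm a
    have c4 := hG.le_left hes.symm b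
    by_cases hpr : p = r
    · exact Or.inl hpr
    refine Or.inr ?_
    have heg : e = g ∨ G.Adj e g := ih hab hes.symm hgs.symm hsa (by omega) hea hgb
    have nve : ¬ G.Adj v e := fun h => by have := hG.le_left h a; omega
    have nvg : ¬ G.Adj v g := fun h => by have := hG.le_left h b; omega
    rcases heg with rfl | heg
    · omega
    have npg : ¬ G.Adj p g := fun h => by have := hG.le_left h b; omega
    have nre : ¬ G.Adj r e := fun h => by have := hG.le_left h a; omega
    have q1 : v ≠ e := by rintro rfl; omega
    have q2 : v ≠ g := by rintro rfl; omega
    have q3 : p ≠ g := by rintro rfl; omega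
    have q4 : e ≠ r := by rintro rfl; omega
    -- In the pentagon v, p, e, g, r the distances to a and b exclude every diagonal but pr.
    rcases hG.five hvp hep.symm heg hgr hvr.symm q1 q2 q3 hpr q4 with h | h | h | h | h
    · exact absurd h nve
    · exact absurd h nvg
    · exact absurd h npg
    · exact h
    · exact absurd h.symm nre

theorem edge_clique_right {M : ℕ} {a b v p r : V} (hab : G.Adj a b) (hvp : G.Adj v p)
    (hvr : G.Adj v r) (hva : G.dist a v = M + 1) (hvb : G.dist b v = M + 1)
    (hp : G.dist a p = M) (hr : G.dist b r = M) : p = r ∨ G.Adj p r := by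
  rw [G.dist_comm] at hva hvb hp hr
  exact hG.edge_clique hab hvp hvr hva hvb hp hr

end IsBridged

end Systolic

/-! ### Lowering the displacement at a vertex of a geodesic -/

namespace Systolic
universe u
variable {V : Type u}

theorem dist_map_iso {G : SimpleGraph V} (hG : G.Connected) (h : G ≃g G) (a b : V) :
    G.dist (h a) (h b) = G.dist a b := by
  have key : ∀ (h : G ≃g G) (a b : V), G.dist (h a) (h b) ≤ G.dist a b := by
    intro h a b
    obtain ⟨p, hp⟩ := hG.exists_walk_length_eq_dist a b
    rw [← hp, ← SimpleGraph.Walk.length_map h.toHom p]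
    exact SimpleGraph.dist_le _
  refine le_antisymm (key h a b) ?_
  simpa using key h.symm (h a) (h b)

namespace IsBridged

variable {G : SimpleGraph V} (hG : IsBridged G) (h : G ≃g G)
include hG

/-- As h u and h w are not adjacent, the clique conditions force d(v, hu) = m + 2 and d(u, hv) = m +
1. The new vertex is the h-preimage of a common neighbour of h u and h v closer to u. -/
theorem descend_of_left {u v w : V} {m : ℕ} (huv : G.Adj u v) (hvw : G.Adj v w) (hne : u ≠ w)
    (nuw : ¬ G.Adj u w) (fu : G.dist u (h u) ≤ m + 1) (fv : G.dist v (h v) = m + 2)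
    (hw : G.dist v (h w) = m + 1) :
    ∃ p, G.Adj u p ∧ G.Adj p w ∧ G.dist p (h p) ≤ m + 1 := by
  have huv' := h.map_rel_iff.2 huv
  have hvw' := h.map_rel_iff.2 hvw
  have nuw' : ¬ (h u = h w ∨ G.Adj (h u) (h w)) := by
    rw [not_or]
    exact ⟨fun e => hne (h.injective e), fun e => nuw (h.map_rel_iff.1 e)⟩
  have b1 := hG.le_right huv'.symm v
  have b2 := hG.le_left huv.symm (h u)
  have b3 : G.dist v (h u) ≠ m + 1 := fun e => nuw' (hG.clique fv e hw huv'.symm hvw')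
  have b4 := hG.le_right huv'.symm u
  have b5 := hG.le_left huv.symm (h v)
  have b6 : G.dist u (h v) ≠ m + 2 := fun e =>
    nuw' (hG.edge_clique_right (M := m + 1) huv huv'.symm hvw' e fv (by omega) hw)
  obtain ⟨z, hz, hzu, hzv⟩ := hG.tri (o := u) (m := m) (by omega) (by omega) huv'
  have b7 := hG.le_right hzv.symm v
  have b8 := hG.le_left huv.symm z
  obtain ⟨q, rfl⟩ := h.surjective z
  have hqu : G.Adj q u := h.map_rel_iff.1 hzu
  refine ⟨q, hqu.symm, ?_, ?_⟩
  · rcases hG.clique (m := m + 1) fv (by omega) hw hzv.symm hvw' with e | e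
    · exact absurd (h.injective e ▸ hqu.symm) nuw
    · exact h.map_rel_iff.1 e
  · have := hG.le_left hqu (h q)
    omega

/-- Either `descend_of_left` applies, or v can be replaced by a common neighbour p of v and w closer
to h w. If p has not yet smaller displacement, `descend_of_left` applies to u, p, w. -/
theorem descend_of_right {u v w : V} {m : ℕ} (huv : G.Adj u v) (hvw : G.Adj v w) (hne : u ≠ w)
    (nuw : ¬ G.Adj u w) (fu : G.dist u (h u) ≤ m + 1) (fv : G.dist v (h v) = m + 2)
    (fw : G.dist w (h w) ≤ m + 2) (hu : G.dist u (h v) = m + 1) :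
    ∃ p, G.Adj u p ∧ G.Adj p w ∧ G.dist p (h p) ≤ m + 1 := by
  have huv' := h.map_rel_iff.2 huv
  have hvw' := h.map_rel_iff.2 hvw
  have b1 := hG.le_right hvw' v
  have b2 := hG.le_left hvw (h w)
  by_cases c1 : G.dist v (h w) = m + 1
  · exact hG.descend_of_left h huv hvw hne nuw fu fv c1
  by_cases c2 : G.dist v (h w) = m + 3
  · have b3 := hG.le_right hvw'.symm u
    have b4 := hG.le_left huv.symm (h w)
    rcases hG.clique_right (m := m + 2) c2 (p := u) (r := w) (by omega) (by omega) huv.symm hvw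
      with e | e
    · exact absurd e hne
    · exact absurd e nuw
  have c3 : G.dist v (h w) = m + 2 := by omega
  by_cases c4 : G.dist w (h w) = m + 2
  · obtain ⟨p, hp, hpv, hpw⟩ := hG.tri_right (m := m + 1) c3 c4 hvw
    have hup : G.Adj u p := by
      rcases hG.edge_clique hvw' huv.symm hpv.symm fv c3 hu hp with e | e
      · exact absurd (e ▸ hpw) nuw
      · exact e
    have b5 := hG.le_right (h.map_rel_iff.2 hpw) p
    by_cases c5 : G.dist p (h p) = m + 2
    · exact hG.descend_of_left h hup hpw hne nuw fu c5 hp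
    · exact ⟨p, hup, hpw, by omega⟩
  · rcases hG.edge_clique hvw' huv.symm hvw fv c3 hu (by omega) with e | e
    · exact absurd e hne
    · exact absurd e nuw

/-- The vertices on either end of a geodesic from v to h v, pulled back by h at the far end, are
adjacent to u (`right`, `left`). It remains to find p near v and h q near h v with d(p, hq) = m and
p, q equal or adjacent (`final`). -/
theorem descend_of_far {u v w : V} {m : ℕ} (huv : G.Adj u v) (hvw : G.Adj v w) (hne : u ≠ w)
    (nuw : ¬ G.Adj u w) (fu : G.dist u (h u) ≤ m + 1) (fv : G.dist v (h v) = m + 2)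
    (fw : G.dist w (h w) ≤ m + 2) (hu : G.dist u (h v) = m + 2) (hu' : G.dist v (h u) = m + 2)
    (hw : G.dist w (h v) = m + 2) :
    ∃ p, G.Adj u p ∧ G.Adj p w ∧ G.dist p (h p) ≤ m + 1 := by
  have huv' := h.map_rel_iff.2 huv
  have hvw' := h.map_rel_iff.2 hvw
  have a1 := hG.le_left huv.symm (h u)
  have right : ∀ p, G.Adj v p → G.dist p (h v) = m + 1 → G.Adj u p := by
    intro p hvp hp
    rcases hG.edge_clique huv' huv.symm hvp hu' fv (by omega) hp with e | e
    · subst e; omega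
    · exact e
  have left : ∀ q, G.Adj v q → G.dist v (h q) = m + 1 → G.Adj u q := by
    intro q hvq hq
    rcases hG.edge_clique_right huv huv'.symm (h.map_rel_iff.2 hvq) hu fv
      (by omega : _ = m + 1) hq with e | e
    · rw [← h.injective e] at hq; omega
    · exact h.map_rel_iff.1 e
  have final : ∀ p q, G.Adj u p → G.Adj p w → G.dist p (h q) = m → (p = q ∨ G.Adj p q) →
      ∃ p, G.Adj u p ∧ G.Adj p w ∧ G.dist p (h p) ≤ m + 1 := by
    intro p q hup hpw hpq hh
    refine ⟨p, hup, hpw, ?_⟩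
    rcases hh with rfl | hh
    · omega
    · have := hG.le_right (h.map_rel_iff.2 hh) p
      omega
  have b1 := hG.le_right hvw' v
  have b2 := hG.le_left hvw (h w)
  by_cases c1 : G.dist v (h w) = m + 1
  · exact hG.descend_of_left h huv hvw hne nuw fu fv c1
  by_cases c2 : G.dist w (h w) = m + 2
  swap
  -- Here d(w, hw) = m + 1. Both p and q are adjacent to u and to w, so the square u, p, w, q gives
  -- the required relation.
  · obtain ⟨p, hvp, hp⟩ := hG.exists_closer fv
    have c3 : G.dist v (h w) = m + 2 := by omega
    have hpw : G.Adj p w := by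
      rcases hG.edge_clique hvw' hvp hvw fv c3 hp (by omega) with e | e
      · subst e; omega
      · exact e
    obtain ⟨z, hz, hzp⟩ := hG.exists_closer_right hp
    obtain ⟨q, rfl⟩ := h.surjective z
    have hvq : G.Adj v q := h.map_rel_iff.1 hz
    have b3 := hG.le_left hvp (h q)
    have b4 := hG.le_right hz v
    have hq : G.dist v (h q) = m + 1 := by omega
    have hup := right p hvp hp
    refine final p q hup hpw hzp (hG.four hup hpw ?_ (left q hvq hq).symm hne nuw)
    rcases hG.edge_clique_right hvw hz hvw' fv hw hq (by omega) with e | e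
    · exact absurd (left q hvq hq) (h.injective e ▸ nuw)
    · exact (h.map_rel_iff.1 e).symm
  by_cases c3 : G.dist v (h w) = m + 2
  · obtain ⟨p, hp, hpv, hpw⟩ := hG.tri_right (m := m + 1) fv hw hvw
    obtain ⟨t, ht, htv, htw⟩ := hG.tri_right (m := m + 1) c3 c2 hvw
    -- One of p, t is closer to both h v and h w; otherwise `edge_clique` makes them equal or
    -- adjacent, against the distances or `quadrilateral`.
    have key : ∃ r, G.Adj v r ∧ G.Adj r w ∧ G.dist r (h v) = m + 1 ∧ G.dist r (h w) = m + 1 := by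
      have b3 := hG.le_right hvw'.symm p
      have b4 := hG.le_right hvw' t
      have b5 := hG.le_left hpv.symm (h w)
      have b6 := hG.le_left htv.symm (h v)
      by_cases c4 : G.dist p (h w) = m + 1
      · exact ⟨p, hpv.symm, hpw, hp, c4⟩
      by_cases c5 : G.dist t (h v) = m + 1
      · exact ⟨t, htv.symm, htw, c5, ht⟩
      rcases hG.edge_clique hvw' hpv.symm htv.symm fv c3 hp ht with rfl | e
      · exact absurd ht c4
      · exact (hG.quadrilateral e hvw' hp ht (by omega) (by omega)).elim
    obtain ⟨r, hvr, hrw, hr, hr'⟩ := key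
    have hur := right r hvr hr
    have b5 := hG.le_right (h.map_rel_iff.2 hrw) r
    by_cases c5 : G.dist r (h r) = m + 2
    · exact hG.descend_of_left h hur hrw hne nuw fu c5 hr'
    · exact ⟨r, hur, hrw, by omega⟩
  · have c4 : G.dist v (h w) = m + 3 := by omega
    obtain ⟨p, hp, hpv, hpw⟩ := hG.tri_right (m := m + 1) fv hw hvw
    have hup := right p hpv.symm hp
    have d1 := hG.le_right hvw'.symm p
    have d2 := hG.le_left hpv.symm (h w)
    obtain ⟨z, hwz, hzv, hzw⟩ := hG.tri (m := m + 1) hw c2 hvw'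
    obtain ⟨q, rfl⟩ := h.surjective z
    have hqv : G.Adj q v := h.map_rel_iff.1 hzv
    have hqw : G.Adj q w := h.map_rel_iff.1 hzw
    have d3 := hG.le_right hzw.symm v
    have d4 := hG.le_left hvw (h q)
    have d5 := hG.le_left hpv.symm (h q)
    have d6 := hG.le_left hpw (h q)
    have hpq : G.dist p (h q) = m + 1 := by
      by_contra hcon
      exact hG.quadrilateral hpw hzv.symm hp hwz (by omega) hw
    obtain ⟨z', hz', hzv', hzq'⟩ := hG.tri hp hpq hzv.symm
    obtain ⟨s, rfl⟩ := h.surjective z'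
    have hsv : G.Adj s v := h.map_rel_iff.1 hzv'
    have hsq : G.Adj s q := h.map_rel_iff.1 hzq'
    have d7 := hG.le_left hpv.symm (h s)
    have d8 := hG.le_right hzv'.symm v
    have hus := left s hsv.symm (by omega)
    have nuq : ¬ G.Adj u q := by
      intro e
      rcases hG.edge_clique (h.map_rel_iff.2 e) huv.symm hvw hu' (by omega) (by omega : _ = m + 1)
        hwz with e | e
      · exact hne e
      · exact nuw e
    have nwq : u ≠ q := by rintro rfl; exact nuw hqw
    -- The pentagon u, p, w, q, s has a diagonal; those joining u to w or q are excluded, and the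
    -- others give p and s adjacent, possibly through a square.
    refine final p s hup hpw hz' ?_
    by_contra hcon
    rw [not_or] at hcon
    have q1 : p ≠ q := by rintro rfl; exact nuq hup
    have q2 : w ≠ s := by rintro rfl; exact nuw hus
    rcases hG.five hup hpw hqw.symm hsq.symm hus.symm hne nwq q1 hcon.1 q2 with e | e | e | e | e
    · exact nuw e
    · exact nuq e
    · rcases hG.four hup e hsq.symm hus.symm nwq nuq with e | e
      · exact hcon.1 e
      · exact hcon.2 e
    · exact hcon.2 e
    · rcases hG.four hup hpw e hus.symm hne nuw with e | e
      · exact hcon.1 e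
      · exact hcon.2 e

/-- If the displacement of `h` at `v` is larger than at `u` and not smaller than at `w`, then the
middle vertex of the geodesic `u, v, w` can be replaced by one of smaller displacement. -/
theorem descend {u v w : V} {m : ℕ} (huv : G.Adj u v) (hvw : G.Adj v w) (hne : u ≠ w)
    (nuw : ¬ G.Adj u w) (fu : G.dist u (h u) ≤ m + 1) (fv : G.dist v (h v) = m + 2)
    (fw : G.dist w (h w) ≤ m + 2) :
    ∃ p, G.Adj u p ∧ G.Adj p w ∧ G.dist p (h p) ≤ m + 1 := by
  -- Passing to the inverse keeps displacements and exchanges d(u, hv) with d(v, hu), and d(v, hw)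
  -- with d(w, hv), which halves the cases.
  have inv : ∀ a b, G.dist a (h.symm b) = G.dist b (h a) := by
    intro a b
    rw [← dist_map_iso hG.connected h, h.apply_symm_apply, G.dist_comm]
  have huv' := h.map_rel_iff.2 huv
  have hvw' := h.map_rel_iff.2 hvw
  have b1 := hG.le_left huv.symm (h v)
  have b2 := hG.le_right huv'.symm v
  have b3 := hG.le_right huv'.symm u
  have b4 := hG.le_left huv.symm (h u)
  have b5 := hG.le_left hvw (h v)
  have b6 := hG.le_right hvw' v
  have b7 := hG.le_left hvw.symm (h v)
  have b8 := hG.le_right hvw'.symm v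
  by_cases c1 : G.dist u (h v) = m + 1
  · exact hG.descend_of_right h huv hvw hne nuw fu fv fw c1
  by_cases c2 : G.dist v (h u) = m + 1
  · simpa only [inv] using hG.descend_of_right (m := m) h.symm huv hvw hne nuw (by rwa [inv])
      (by rwa [inv]) (by rwa [inv]) (by rwa [inv])
  by_cases c3 : G.dist v (h w) = m + 1
  · exact hG.descend_of_left h huv hvw hne nuw fu fv c3
  by_cases c4 : G.dist w (h v) = m + 1
  · simpa only [inv] using hG.descend_of_left (m := m) h.symm huv hvw hne nuw (by rwa [inv])
      (by rwa [inv]) (by rwa [inv])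
  have c5 : G.dist u (h v) = m + 2 := by omega
  have c6 : G.dist v (h u) = m + 2 := by omega
  by_cases c7 : G.dist w (h v) = m + 2
  · exact hG.descend_of_far h huv hvw hne nuw fu fv fw c5 c6 c7
  by_cases c8 : G.dist v (h w) = m + 2
  · simpa only [inv] using hG.descend_of_far (m := m) h.symm huv hvw hne nuw (by rwa [inv])
      (by rwa [inv]) (by rwa [inv]) (by rwa [inv]) (by rwa [inv]) (by rwa [inv])
  have b9 := hG.le_left hvw.symm (h w)
  have b10 := hG.le_right hvw' w
  have b11 := hG.le_right hvw'.symm w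
  have b12 := hG.le_left hvw (h w)
  -- Both mixed distances between v and w now equal m + 3, while both displacements are m + 2.
  exact (hG.quadrilateral (k := m + 1) hvw hvw' fv (by omega) (by omega) (by omega)).elim

end IsBridged

end Systolic

/-! ### Geodesics inside the minimal displacement set -/

namespace Systolic
universe u
variable {V : Type u}

namespace IsBridged

variable {G : SimpleGraph V} (hG : IsBridged G) (h : G ≃g G)
include hG

theorem dist_le_of_chain {c : ℕ → V} {n : ℕ} (hc : ∀ i ≤ n, G.Adj (c i) (c (i + 1))) (i : ℕ) :
    ∀ k, i + k ≤ n + 1 → G.dist (c i) (c (i + k)) ≤ k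
  | 0, _ => by simp
  | k + 1, hk => by
    have h1 := dist_le_of_chain hc i k (by omega)
    have h2 := hG.le_right (hc (i + k) (by omega)).symm (c i)
    rw [← add_assoc]
    omega

/-- Induction on the total displacement along a geodesic: as long as some vertex is not minimally
displaced, `descend` lowers the sum while the ends stay fixed. -/
theorem exists_geodesic_min {L n : ℕ} (hL : 1 ≤ L) (hmin : ∀ v, L ≤ G.dist v (h v)) {x y : V}
    (hx : G.dist x (h x) = L) (hy : G.dist y (h y) = L) (hxy : G.dist x y = n + 1) :
    ∀ (N : ℕ) (c : ℕ → V), c 0 = x → c (n + 1) = y → (∀ i ≤ n, G.Adj (c i) (c (i + 1))) →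
      ∑ i ∈ Finset.range (n + 2), G.dist (c i) (h (c i)) = N →
      ∃ c : ℕ → V, c 0 = x ∧ c (n + 1) = y ∧ (∀ i ≤ n, G.Adj (c i) (c (i + 1))) ∧
        ∀ i ≤ n + 1, G.dist (c i) (h (c i)) = L := by
  intro N
  induction N using Nat.strong_induction_on with
  | _ N ih =>
    intro c c0 cn hc hS
    by_cases hall : ∀ i ≤ n + 1, G.dist (c i) (h (c i)) = L
    · exact ⟨c, c0, cn, hc, hall⟩
    push Not at hall
    obtain ⟨b, hb, hbL⟩ := hall
    obtain ⟨k, hk, hmax⟩ := Finset.exists_max_image (Finset.range (n + 2))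
      (fun i => G.dist (c i) (h (c i))) ⟨b, by simp; omega⟩
    simp only [Finset.mem_range] at hk hmax
    have hM : L < G.dist (c k) (h (c k)) := by
      have h1 := hmax b (by omega)
      have h2 := hmin (c b)
      omega
    have hex : ∃ j, j < n + 2 ∧ G.dist (c j) (h (c j)) = G.dist (c k) (h (c k)) := ⟨k, hk, rfl⟩
    classical
    -- The first index attaining the maximum has a predecessor of strictly smaller displacement, as
    -- `descend` requires.
    obtain ⟨hj, hjM⟩ := Nat.find_spec hex
    have hlt := fun i hi => Nat.find_min hex (m := i) hi
    generalize Nat.find hex = j at hj hjM hlt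
    obtain ⟨m, hm⟩ : ∃ m, G.dist (c k) (h (c k)) = m + 2 := ⟨_, (Nat.sub_add_cancel (by omega)).symm⟩
    rw [hm] at hM hjM hmax hlt
    have j0 : j ≠ 0 := by rintro rfl; rw [c0, hx] at hjM; omega
    have jn : j ≠ n + 1 := by rintro rfl; rw [cn, hy] at hjM; omega
    obtain ⟨i, rfl⟩ := Nat.exists_eq_add_one_of_ne_zero j0
    have fu : G.dist (c i) (h (c i)) ≤ m + 1 := by
      have h1 := hlt i (by omega)
      have h2 := hmax i (by omega)
      rw [not_and] at h1
      have := h1 (by omega)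
      omega
    -- The chain has as many edges as the distance of its ends, so no shortcut is possible.
    have hfar : 2 ≤ G.dist (c i) (c (i + 2)) := by
      have h1 := hG.dist_le_of_chain hc 0 i (by omega)
      have h2 := hG.dist_le_of_chain hc (i + 2) (n + 1 - (i + 2)) (by omega)
      rw [show i + 2 + (n + 1 - (i + 2)) = n + 1 by omega, cn] at h2
      rw [zero_add, c0] at h1
      have h3 := hG.connected.dist_triangle (u := x) (v := c i) (w := y)
      have h4 := hG.connected.dist_triangle (u := c i) (v := c (i + 2)) (w := y)
      omega
    obtain ⟨p, hip, hpi, hp⟩ := hG.descend h (hc i (by omega)) (hc (i + 1) (by omega))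
      (fun e => by rw [← e] at hfar; simp at hfar)
      (fun e => by rw [SimpleGraph.dist_eq_one_iff_adj.2 e] at hfar; omega) fu hjM
      (hmax (i + 2) (by omega))
    have hother : ∀ l, l ≠ i + 1 → Function.update c (i + 1) p l = c l :=
      fun l hl => Function.update_of_ne hl _ _
    have hself : Function.update c (i + 1) p (i + 1) = p := Function.update_self ..
    refine ih _ ?_ (Function.update c (i + 1) p) ?_ ?_ ?_ rfl
    · rw [← hS]
      refine Finset.sum_lt_sum (fun l _ => ?_) ⟨i + 1, by simp; omega, ?_⟩
      · by_cases hl : l = i + 1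
        · subst hl; rw [hself]; omega
        · rw [hother l hl]
      · rw [hself]; omega
    · rw [hother 0 (by omega), c0]
    · rw [hother _ (by omega), cn]
    · intro l hl
      by_cases h1 : l = i
      · subst h1; rw [hother l (by omega), hself]; exact hip
      by_cases h2 : l = i + 1
      · subst h2; rw [hother (i + 1 + 1) (by omega), hself]; exact hpi
      rw [hother l h2, hother (l + 1) (by omega)]
      exact hc l hl

/-- The set where the displacement is minimal is isometrically embedded: a geodesic between two of
its points can be chosen to begin inside it. -/
theorem exists_adj_min {L n : ℕ} (hL : 1 ≤ L) (hmin : ∀ v, L ≤ G.dist v (h v)) {x y : V}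
    (hx : G.dist x (h x) = L) (hy : G.dist y (h y) = L) (hxy : G.dist x y = n + 1) :
    ∃ z, G.Adj x z ∧ G.dist z (h z) = L ∧ G.dist z y = n := by
  obtain ⟨p, hp⟩ := hG.connected.exists_walk_length_eq_dist x y
  rw [hxy] at hp
  obtain ⟨c, rfl, rfl, hc, hf⟩ := hG.exists_geodesic_min h hL hmin hx hy hxy _ p.getVert
    p.getVert_zero (by rw [← hp, p.getVert_length]) (fun i hi => p.adj_getVert_succ (by omega)) rfl
  have h1 := hG.dist_le_of_chain hc 1 n (by omega)
  have h2 := hG.le_left (hc 0 (by omega)) (c (n + 1))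
  rw [add_comm 1 n] at h1
  rw [zero_add] at h2
  exact ⟨c 1, hc 0 (by omega), hf 1 (by omega), by omega⟩

end IsBridged

end Systolic

/-! ### Translation along axes and the Busemann function -/

namespace Systolic
universe u
variable {V : Type u} {X : AbstractSimplicialComplex V} {h : V ≃ V}

/-- A simplicial automorphism as an automorphism of the 1-skeleton. -/
def IsAutomorphism.toIso (hh : IsAutomorphism X h) :
    skeleton X.toPreAbstractSimplicialComplex ≃g skeleton X.toPreAbstractSimplicialComplex where
  toEquiv := h
  map_rel_iff' := by
    intro a b
    constructor
    · rintro ⟨hne, s, hs, ha, hb⟩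
      refine ⟨fun e => hne (congrArg h e), s.map h.symm.toEmbedding, ?_, by simpa using ha,
        by simpa using hb⟩
      rw [← hh, Finset.map_map]
      convert hs
      ext
      simp
    · rintro ⟨hne, s, hs, ha, hb⟩
      exact ⟨fun e => hne (h.injective e), _, (hh s).2 hs, by simpa using ha, by simpa using hb⟩

theorem vdist_map (hX : IsSystolic X) (hh : IsAutomorphism X h) (a b : V) :
    vdist X (h a) (h b) = vdist X a b :=
  dist_map_iso hX.connected hh.toIso a b

theorem vdist_comm (a b : V) : vdist X a b = vdist X b a := SimpleGraph.dist_comm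

theorem vdist_triangle (hX : IsSystolic X) (a b c : V) :
    vdist X a c ≤ vdist X a b + vdist X b c := hX.connected.dist_triangle

theorem translationLength_le (v : V) : translationLength X h ≤ vdist X v (h v) :=
  Nat.sInf_le ⟨v, rfl⟩

theorem IsGeodesic.injective {γ : ℤ → V} (hγ : IsGeodesic X γ) : Function.Injective γ := by
  intro i j e
  have := hγ i j
  rw [e] at this
  simp only [vdist, SimpleGraph.dist_self] at this
  omega

/-- If no vertex is moved by at most 1, then an axis is translated. -/
theorem IsGeodesic.exists_translation (hX : IsSystolic X) (hh : IsAutomorphism X h)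
    (hL : 1 < translationLength X h) {γ : ℤ → V} (hγ : IsGeodesic X γ)
    (hA : h '' Set.range γ = Set.range γ) : ∃ c : ℤ, ∀ t, h (γ t) = γ (t + c) := by
  have hφ : ∀ t, ∃ s, γ s = h (γ t) := fun t => by
    rw [← Set.mem_range, ← hA]
    exact ⟨_, ⟨t, rfl⟩, rfl⟩
  choose φ hφ using hφ
  have hd : ∀ i j, (φ i - φ j).natAbs = (i - j).natAbs := by
    intro i j
    rw [← hγ, hφ, hφ, vdist_map hX hh, hγ]
  have hm : ∀ t, 1 < (t - φ t).natAbs := by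
    intro t
    rw [← hγ, hφ]
    exact hL.trans_le (translationLength_le _)
  refine ⟨φ 0, fun t => ?_⟩
  rw [← hφ]
  congr 1
  have h0 := hd t 0
  have h1 := hd t 1
  have h2 := hd 1 0
  -- The induced isometry of ℤ is a translation or a reflection; a reflection would move the integer
  -- nearest its centre by at most 1.
  have h3 := hd (φ 0 / 2) 0
  have h4 := hd (φ 0 / 2) 1
  have h5 := hm (φ 0 / 2)
  omega

theorem IsAxis.subset_minSet (hX : IsSystolic X) (hh : IsAutomorphism X h)
    (hL : 1 < translationLength X h) {A : Set V} (hA : IsAxis X h A) {x : V} (hx : x ∈ A)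
    (hxm : x ∈ minSet X h) : A ⊆ minSet X h := by
  obtain ⟨⟨γ, hγ, rfl⟩, hA⟩ := hA
  obtain ⟨c, hc⟩ := hγ.exists_translation hX hh hL hA
  obtain ⟨s, rfl⟩ := hx
  rintro _ ⟨t, rfl⟩
  simp only [minSet, Set.mem_ofPred_eq, hc, hγ _ _] at hxm ⊢
  omega

theorem Axes.exists_orientedParam (hX : IsSystolic X) (hh : IsAutomorphism X h)
    (hL : 1 < translationLength X h) (A : Axes X h) : ∃ γ, IsOrientedParam X h A γ := by
  obtain ⟨A, ⟨⟨γ, hγ, rfl⟩, hA⟩, hm⟩ := A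
  obtain ⟨c, hc⟩ := hγ.exists_translation hX hh hL hA
  have h0 : vdist X (γ 0) (h (γ 0)) = translationLength X h := hm ⟨0, rfl⟩
  rw [hc, hγ] at h0
  rcases lt_or_ge 0 c with h1 | h1
  · exact ⟨γ, hγ, rfl, fun t => ⟨t + c, by omega, hc t⟩⟩
  · refine ⟨fun t => γ (-t), fun i j => ?_, ?_, fun t => ⟨t - c, by omega, ?_⟩⟩
    · rw [hγ]; omega
    · exact (Equiv.neg ℤ).surjective.range_comp γ
    · rw [hc]
      congr 1
      omega

theorem IsOrientedParam.map_eq {A : Axes X h} {γ : ℤ → V} (hγ : IsOrientedParam X h A γ) (t : ℤ) :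
    h (γ t) = γ (t + translationLength X h) := by
  obtain ⟨s, hs, e⟩ := hγ.2.2 t
  have h1 : vdist X (γ t) (h (γ t)) = translationLength X h := A.2.2 (hγ.2.1 ▸ ⟨t, rfl⟩)
  rw [e, hγ.1] at h1
  rw [e]
  congr 1
  omega

/-- The Busemann function of the negative end of an axis, and the horoball as its sublevel set. -/
theorem IsOrientedParam.exists_busemann (hX : IsSystolic X) (hh : IsAutomorphism X h)
    {A : Axes X h} {γ : ℤ → V} (hγ : IsOrientedParam X h A γ) :
    ∃ β : V → ℤ, (∀ x y, β x ≤ β y + vdist X x y) ∧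
      (∀ x, β (h x) = β x + translationLength X h) ∧ ∀ x, x ∈ horoball X γ ↔ β x ≤ 0 := by
  have hβ : ∀ x, ∃ b : ℤ, (∀ n : ℕ, (n : ℤ) + b ≤ vdist X (γ (-n)) x) ∧
      ∃ N : ℕ, ∀ n ≥ N, (vdist X (γ (-n)) x : ℤ) = n + b := by
    intro x
    -- The integers d(γ(-n), x) - n do not increase with n and are bounded below, so they are
    -- eventually equal to their minimum, the value of β.
    obtain ⟨b, ⟨N, hN⟩, hb⟩ := Int.exists_least_of_bdd
      (P := fun z => ∃ n : ℕ, (vdist X (γ (-n)) x : ℤ) - n = z) (by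
        refine ⟨-vdist X (γ 0) x, ?_⟩
        rintro _ ⟨n, rfl⟩
        have h1 := vdist_triangle hX (γ 0) x (γ (-n))
        have h2 := hγ.1 0 (-n)
        rw [vdist_comm x] at h1
        omega) ⟨_, 0, rfl⟩
    refine ⟨b, fun n => ?_, N, fun n hn => ?_⟩
    · have := hb _ ⟨n, rfl⟩
      omega
    · have h1 := hb _ ⟨n, rfl⟩
      have h2 := vdist_triangle hX (γ (-n)) (γ (-N)) x
      have h3 := hγ.1 (-n) (-N)
      omega
  choose β hβ hβ' using hβ
  choose N hN using hβ'
  refine ⟨β, fun x y => ?_, fun x => ?_, fun x => ⟨?_, fun hx => ?_⟩⟩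
  · have h1 := hN x (max (N x) (N y)) (le_max_left _ _)
    have h2 := hN y (max (N x) (N y)) (le_max_right _ _)
    have h3 := vdist_triangle hX (γ (-(max (N x) (N y) : ℕ))) y x
    rw [vdist_comm y x] at h3
    omega
  · have h1 := hN (h x) (N x + N (h x)) (by omega)
    have h2 := hN x (N x + N (h x) + translationLength X h) (by omega)
    rw [← vdist_map hX hh, hγ.map_eq] at h2
    have e : -((N x + N (h x) + translationLength X h : ℕ) : ℤ) + translationLength X h =
        -((N x + N (h x) : ℕ) : ℤ) := by push_cast; ring
    rw [e] at h2
    omega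
  · rintro ⟨n, hn⟩
    have := hβ x n
    omega
  · refine ⟨N x, ?_⟩
    have := hN x (N x) le_rfl
    omega

/-- A step raises β by at most 1, and L consecutive steps raise it by exactly L, so every step
raises it by 1. The axis need not be the one defining β. -/
theorem IsOrientedParam.busemann_eq (hL : 0 < translationLength X h)
    {A : Axes X h} {γ : ℤ → V} (hγ : IsOrientedParam X h A γ) {β : V → ℤ}
    (hβ : ∀ x y, β x ≤ β y + vdist X x y)
    (hβh : ∀ x, β (h x) = β x + translationLength X h) (t : ℤ) : β (γ t) = β (γ 0) + t := by
  have step : ∀ t, β (γ (t + 1)) = β (γ t) + 1 := by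
    intro t
    have h1 := hβ (γ (t + 1)) (γ t)
    have h2 := hβ (γ (t + translationLength X h)) (γ (t + 1))
    rw [hγ.1] at h1 h2
    rw [← hγ.map_eq, hβh] at h2
    omega
  induction t using Int.induction_on with
  | zero => simp
  | succ n ih => rw [step, ih]; ring
  | pred n ih =>
    have := step (-n - 1)
    rw [sub_add_cancel] at this
    omega

theorem IsOrientedParam.shift {A : Axes X h} {γ : ℤ → V} (hγ : IsOrientedParam X h A γ) (c : ℤ) :
    IsOrientedParam X h A fun t => γ (t + c) := by
  refine ⟨fun i j => ?_, ?_, fun t => ⟨t + translationLength X h, ?_, ?_⟩⟩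
  · rw [hγ.1]; congr 1; ring
  · rw [← hγ.2.1]
    exact (Equiv.addRight c).surjective.range_comp γ
  · obtain ⟨s, hs, e⟩ := hγ.2.2 t
    rw [hγ.map_eq] at e
    have := hγ.1.injective e
    omega
  · rw [hγ.map_eq]; congr 1; ring

theorem isGreatest_horoball_iff (hL : 0 < translationLength X h)
    {A : Axes X h} {γ γ₀ : ℤ → V} (hγ : IsOrientedParam X h A γ) {β : V → ℤ}
    (hβ : ∀ x y, β x ≤ β y + vdist X x y)
    (hβh : ∀ x, β (h x) = β x + translationLength X h)
    (hΩ : ∀ x, x ∈ horoball X γ₀ ↔ β x ≤ 0) :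
    IsGreatest {t : ℤ | γ t ∈ horoball X γ₀} 0 ↔ β (γ 0) = 0 := by
  simp only [IsGreatest, upperBounds, Set.mem_ofPred_eq, hΩ]
  constructor
  · rintro ⟨h1, h2⟩
    have := @h2 (-β (γ 0)) (by rw [hγ.busemann_eq hL hβ hβh]; omega)
    omega
  · intro h0
    refine ⟨h0.le, fun t ht => ?_⟩
    rw [hγ.busemann_eq hL hβ hβh] at ht
    omega

theorem existsUnique_axesParam (hX : IsSystolic X) (hh : IsAutomorphism X h)
    (hL : 1 < translationLength X h) {γ₀ : ℤ → V} {β : V → ℤ}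
    (hβ : ∀ x y, β x ≤ β y + vdist X x y)
    (hβh : ∀ x, β (h x) = β x + translationLength X h)
    (hΩ : ∀ x, x ∈ horoball X γ₀ ↔ β x ≤ 0) : ∃! p : Axes X h → ℤ → V, IsAxesParam X h γ₀ p := by
  have hL' : 0 < translationLength X h := by omega
  choose q hq using fun A : Axes X h => A.exists_orientedParam hX hh hL
  -- The shift by -β moves the level-zero vertex of each axis to the origin.
  refine ⟨fun A t => q A (t + -β (q A 0)), fun A => ⟨(hq A).shift _, ?_⟩, ?_⟩
  · rw [isGreatest_horoball_iff hL' ((hq A).shift _) hβ hβh hΩ, (hq A).busemann_eq hL' hβ hβh]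
    ring
  · intro p hp
    funext A t
    obtain ⟨h1, h2⟩ := hp A
    rw [isGreatest_horoball_iff hL' h1 hβ hβh hΩ] at h2
    obtain ⟨s, hs⟩ : p A t ∈ Set.range (q A) := by
      rw [(hq A).2.1, ← h1.2.1]
      exact ⟨t, rfl⟩
    have h3 := h1.busemann_eq hL' hβ hβh t
    rw [← hs, (hq A).busemann_eq hL' hβ hβh] at h3
    rw [← hs]
    congr 1
    omega

/-! ### Distances in the graph of axes and the quasi-isometry -/

theorem dMin_le {A B : Set V} {a b : V} (ha : a ∈ A) (hb : b ∈ B) : dMin X A B ≤ vdist X a b :=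
  Nat.sInf_le ⟨a, ha, b, hb, rfl⟩

theorem exists_axis_through (hX : IsSystolic X) (hh : IsAutomorphism X h)
    (hL : 1 < translationLength X h) (hax : MinSetIsUnionOfAxes X h) {x : V}
    (hx : x ∈ minSet X h) : ∃ A : Axes X h, x ∈ A.1 := by
  obtain ⟨A, hA, hxA⟩ := hax x hx
  exact ⟨⟨A, hA, hA.subset_minSet hX hh hL hxA hx⟩, hxA⟩

/-- Axes are joined in the graph of axes by walks not much longer than their distance in `X`. -/
theorem exists_axes_walk (hX : IsSystolic X) (hh : IsAutomorphism X h)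
    (hL : 1 < translationLength X h) (hax : MinSetIsUnionOfAxes X h) (n : ℕ) :
    ∀ (A B : Axes X h) (x y : V), x ∈ A.1 → y ∈ B.1 → vdist X x y = n →
      ∃ p : (axesGraph X h).Walk A B, p.length ≤ n + 1 := by
  have one : ∀ (A B : Axes X h) (x y : V), x ∈ A.1 → y ∈ B.1 → vdist X x y ≤ 1 →
      ∃ p : (axesGraph X h).Walk A B, p.length ≤ 1 := by
    intro A B x y hx hy hxy
    by_cases e : A = B
    · subst e; exact ⟨.nil, Nat.zero_le _⟩
    · exact ⟨.cons ⟨e, (dMin_le hx hy).trans hxy⟩ .nil, le_rfl⟩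
  induction n with
  | zero =>
    intro A B x y hx hy hxy
    simpa using one A B x y hx hy (by omega)
  | succ n ih =>
    intro A B x y hx hy hxy
    -- The next vertex of the geodesic stays in Min(h), so an axis passes through it. The extra 1 in
    -- the bound pays for changing axes at the final vertex.
    obtain ⟨z, hxz, hz, hzy⟩ := hX.isBridged.exists_adj_min hh.toIso
      (L := translationLength X h) (by omega) (fun v => translationLength_le v)
      (A.2.2 hx) (B.2.2 hy) hxy
    obtain ⟨C, hC⟩ := exists_axis_through hX hh hL hax hz
    obtain ⟨p, hp⟩ := one A C x z hx hC (SimpleGraph.dist_eq_one_iff_adj.2 hxz).le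
    obtain ⟨q, hq⟩ := ih C B z y hC hy hzy
    refine ⟨p.append q, ?_⟩
    rw [SimpleGraph.Walk.length_append]
    omega

section param

variable {p : Axes X h → ℤ → V}

/-- A pair of points realising distance at most 1 has parameters differing by at most 1, by β. Its
translates under powers of h recur with period L, and one of them is less than L before time t. -/
theorem vdist_le_of_adj (hX : IsSystolic X) (hh : IsAutomorphism X h)
    (hL : 0 < translationLength X h) {β : V → ℤ} (hβ : ∀ x y, β x ≤ β y + vdist X x y)
    (hp : ∀ A, IsOrientedParam X h A (p A)) (hpβ : ∀ A t, β (p A t) = t) {A B : Axes X h}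
    (hAB : (axesGraph X h).Adj A B) (t : ℤ) :
    vdist X (p A t) (p B t) ≤ 2 * translationLength X h + 2 := by
  obtain ⟨a, ha, b, hb, hab⟩ : dMin X A.1 B.1 ∈
      {n | ∃ a ∈ A.1, ∃ b ∈ B.1, vdist X a b = n} :=
    Nat.sInf_mem ⟨_, p A 0, (hp A).2.1 ▸ ⟨0, rfl⟩, p B 0, (hp B).2.1 ▸ ⟨0, rfl⟩, rfl⟩
  rw [← (hp A).2.1] at ha
  rw [← (hp B).2.1] at hb
  obtain ⟨s, rfl⟩ := ha
  obtain ⟨s', rfl⟩ := hb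
  have hle : vdist X (p A s) (p B s') ≤ 1 := hab ▸ hAB.2
  have h1 := hβ (p A s) (p B s')
  have h2 := hβ (p B s') (p A s)
  rw [vdist_comm (p B s')] at h2
  rw [hpβ, hpβ] at h1 h2
  have hper : Function.Periodic (fun r => vdist X (p A r) (p B (r + (s' - s))))
      (translationLength X h : ℤ) := by
    intro r
    dsimp only
    rw [← vdist_map hX hh (p A r), (hp A).map_eq, (hp B).map_eq]
    congr 2
    ring
  set k := (t - s) / (translationLength X h : ℤ) with hk
  have h3 := hper.int_mul k s
  dsimp only [Int.cast_id] at h3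
  have h4 := Int.emod_nonneg (t - s) (b := translationLength X h) (by omega)
  have h5 := Int.emod_lt_of_pos (t - s) (b := translationLength X h) (by omega)
  have h6 := Int.mul_ediv_add_emod (t - s) (translationLength X h)
  rw [← hk, mul_comm] at h6
  generalize (t - s) % (translationLength X h : ℤ) = e at h4 h5 h6
  generalize k * (translationLength X h : ℤ) = d at h3 h6
  rw [show s + (s' - s) = s' by ring, show s + d + (s' - s) = s' + d by ring] at h3
  have h7 := vdist_triangle hX (p A t) (p A (s + d)) (p B t)
  have h8 := vdist_triangle hX (p A (s + d)) (p B (s' + d)) (p B t)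
  rw [(hp A).1] at h7
  rw [(hp B).1] at h8
  omega

theorem vdist_le_of_walk (hX : IsSystolic X) (hh : IsAutomorphism X h)
    (hL : 0 < translationLength X h) {β : V → ℤ} (hβ : ∀ x y, β x ≤ β y + vdist X x y)
    (hp : ∀ A, IsOrientedParam X h A (p A)) (hpβ : ∀ A t, β (p A t) = t) {A B : Axes X h}
    (w : (axesGraph X h).Walk A B) (t : ℤ) :
    vdist X (p A t) (p B t) ≤ (2 * translationLength X h + 2) * w.length := by
  induction w with
  | nil => simp [vdist]
  | @cons A B C e w ih =>
    have h1 := vdist_le_of_adj hX hh hL hβ hp hpβ e t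
    have h2 := vdist_triangle hX (p A t) (p B t) (p C t)
    rw [SimpleGraph.Walk.length_cons, mul_add_one]
    omega

end param

theorem axes_nonempty (hX : IsSystolic X) (hh : IsAutomorphism X h)
    (hL : 1 < translationLength X h) (hax : MinSetIsUnionOfAxes X h) : Nonempty (Axes X h) := by
  obtain ⟨v₀⟩ := hX.connected.nonempty
  obtain ⟨v, hv⟩ : translationLength X h ∈ Set.range fun v => vdist X v (h v) :=
    Nat.sInf_mem ⟨_, v₀, rfl⟩
  obtain ⟨A, -⟩ := exists_axis_through hX hh hL hax (x := v) hv
  exact ⟨A⟩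

theorem axesGraph_connected (hX : IsSystolic X) (hh : IsAutomorphism X h)
    (hL : 1 < translationLength X h) (hax : MinSetIsUnionOfAxes X h) :
    (axesGraph X h).Connected := by
  have := axes_nonempty hX hh hL hax
  refine ⟨fun A B => ?_⟩
  obtain ⟨γ, hγ⟩ := A.exists_orientedParam hX hh hL
  obtain ⟨δ, hδ⟩ := B.exists_orientedParam hX hh hL
  obtain ⟨p, -⟩ := exists_axes_walk hX hh hL hax _ A B (γ 0) (δ 0) (hγ.2.1 ▸ ⟨0, rfl⟩)
    (hδ.2.1 ▸ ⟨0, rfl⟩) rfl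
  exact ⟨p⟩

/-- A surjection which distorts distances in an affinely bounded way is a quasi-isometry. -/
theorem isQuasiIsometry_of_surjective {α β : Type*} {dα : α → α → ℝ} {dβ : β → β → ℝ} {f : α → β}
    {K : ℝ} (hK : 0 < K) (hf : Function.Surjective f) (hβ : ∀ x, dβ x x = 0)
    (lower : ∀ x y, dα x y ≤ 2 * dβ (f x) (f y) + 1)
    (upper : ∀ x y, dβ (f x) (f y) ≤ K * dα x y) : IsQuasiIsometry dα dβ f := by
  obtain ⟨g, hg⟩ := hf.hasRightInverse
  refine ⟨⟨1 / 2, 1 / 2, K, 0, by norm_num, hK.le, fun x y => ⟨?_, ?_⟩⟩, g,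
    ⟨1 / K, 0, 2, 1, by positivity, by norm_num, fun x y => ⟨?_, ?_⟩⟩, ⟨1, zero_le_one, fun x => ?_⟩,
    ⟨0, le_rfl, fun x => ?_⟩⟩
  · linarith [lower x y]
  · linarith [upper x y]
  · have := upper (g x) (g y)
    rw [hg x, hg y] at this
    rw [sub_zero, one_div, inv_mul_le_iff₀ hK]
    exact this
  · have := lower (g x) (g y)
    rwa [hg x, hg y] at this
  -- Two preimages of one point have image distance 0, so they lie within the additive constant 1.
  · have := lower (g (f x)) x
    rw [hg (f x), hβ] at this
    simpa using this
  · rw [Function.comp_apply, hg x, id, hβ]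

end Systolic

open Systolic in
theorem theorem3p3 {V : Type*} (X : AbstractSimplicialComplex V) (hX : IsSystolic X)
    (hfin : IsUniformlyLocallyFinite X) (h : V ≃ V) (hh : IsHyperbolic X h)
    (hL : 3 < translationLength X h) (hax : MinSetIsUnionOfAxes X h) :
    (axesGraph X h).Connected ∧
    (∃ (A₀ : Axes X h) (γ₀ : ℤ → V), IsOrientedParam X h A₀ γ₀) ∧
    ∀ (A₀ : Axes X h) (γ₀ : ℤ → V), IsOrientedParam X h A₀ γ₀ →
      (∃! p : Axes X h → ℤ → V, IsAxesParam X h γ₀ p) ∧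
      ∀ (p : Axes X h → ℤ → V) (hp : IsAxesParam X h γ₀ p),
        Function.Surjective (axesMap X h γ₀ p hp) ∧
        IsQuasiIsometry (prodDist X h) (minDist X h) (axesMap X h γ₀ p hp) := by
  replace hh := hh.1
  have hL1 : 1 < translationLength X h := by omega
  have hL0 : 0 < translationLength X h := by omega
  have hconn := axesGraph_connected hX hh hL1 hax
  refine ⟨hconn, ?_, fun A₀ γ₀ hγ₀ => ?_⟩
  · obtain ⟨A⟩ := hconn.nonempty
    exact ⟨A, A.exists_orientedParam hX hh hL1⟩
  obtain ⟨β, hβ, hβh, hΩ⟩ := hγ₀.exists_busemann hX hh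
  refine ⟨existsUnique_axesParam hX hh hL1 hβ hβh hΩ, fun p hp => ?_⟩
  have hpo : ∀ A, IsOrientedParam X h A (p A) := fun A => (hp A).1
  have hpβ : ∀ A t, β (p A t) = t := by
    intro A t
    rw [(hpo A).busemann_eq hL0 hβ hβh,
      (isGreatest_horoball_iff hL0 (hpo A) hβ hβh hΩ).1 (hp A).2, zero_add]
  have hmem : ∀ A t, p A t ∈ A.1 := fun A t => (hpo A).2.1 ▸ ⟨t, rfl⟩
  have hsurj : Function.Surjective (axesMap X h γ₀ p hp) := by
    rintro ⟨x, hx⟩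
    obtain ⟨A, hA⟩ := exists_axis_through hX hh hL1 hax hx
    rw [← (hpo A).2.1] at hA
    obtain ⟨t, rfl⟩ := hA
    exact ⟨(A, t), rfl⟩
  refine ⟨hsurj, isQuasiIsometry_of_surjective (K := 2 * translationLength X h + 2) (by positivity)
    hsurj (fun x => by simp [minDist, vdist]) ?_ ?_⟩
  · rintro ⟨A, s⟩ ⟨B, t⟩
    simp only [prodDist, minDist, axesMap]
    obtain ⟨w, hw⟩ := exists_axes_walk hX hh hL1 hax _ A B _ _ (hmem A s) (hmem B t) rfl
    have h1 : ((axesGraph X h).dist A B : ℝ) ≤ vdist X (p A s) (p B t) + 1 := by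
      exact_mod_cast (SimpleGraph.dist_le w).trans hw
    have h2 := hβ (p A s) (p B t)
    have h3 := hβ (p B t) (p A s)
    rw [vdist_comm (p B t)] at h3
    rw [hpβ, hpβ] at h2 h3
    -- The parameters are the values of β, which is 1-Lipschitz.
    have h4 : |(s : ℝ) - t| ≤ vdist X (p A s) (p B t) := by
      have : |s - t| ≤ (vdist X (p A s) (p B t) : ℤ) := by rw [abs_le]; omega
      exact_mod_cast this
    linarith
  · rintro ⟨A, s⟩ ⟨B, t⟩
    simp only [prodDist, minDist, axesMap]
    -- Change axes at the fixed time s, then move along B from s to t.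
    obtain ⟨w, hw⟩ := hconn.exists_walk_length_eq_dist A B
    have h1 := vdist_le_of_walk hX hh hL0 hβ hpo hpβ w s
    have h2 := vdist_triangle hX (p A s) (p B s) (p B t)
    rw [(hpo B).1] at h2
    rw [hw] at h1
    have h3 : (vdist X (p A s) (p B t) : ℝ) ≤
        (2 * translationLength X h + 2) * (axesGraph X h).dist A B + |(s : ℝ) - t| := by
      have h4 : ((s - t).natAbs : ℝ) = |(s : ℝ) - t| := by
        rw [Nat.cast_natAbs]
        push_cast
        rfl
      rw [← h4]
      exact_mod_cast h2.trans (Nat.add_le_add_right h1 _)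
    refine h3.trans ?_
    rw [mul_add]
    gcongr
    refine le_mul_of_one_le_left (abs_nonneg _) ?_
    have : (0 : ℝ) ≤ translationLength X h := Nat.cast_nonneg _
    linarith
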